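/- Let $D_n^+\subset\mathbb R^n$ be the set of vectors whose coordinates lie either all in $\mathbb Z$ or all in $\mathbb Z+\tfrac12$ and whose coordinate sum is an even integer. Let $E_8=D_8^+$, and let $E_8^2=E_8\oplus E_8\subset\mathbb R^{8}\oplus\mathbb R^8$ be the orthogonal direct sum. (Recall that $E_8^2$ and $D_{16}^+$ are, up to isomorphism, the two even unimodular positive definite lattices of rank $16$.) Let $L$ be a lattice of rank at most $3$, that is, a free abelian group of rank at most $3$ equipped with a positive definite symmetric bilinear form $(\cdot,\cdot)$ with real values. An embedding of $L$ into a lattice $\Lambda$ is an injective group homomorphism $\varphi:L\to\Lambda$ with $(\varphi(x),\varphi(y))=(x,y)$ for all $x,y\in L$. Then the number of embeddings of $L$ into $E_8^2$ and the number of embeddings of $L$ into $D_{16}^+$ are finite and equal. -/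

import Mathlib

noncomputable section

/-- The lattice `D_n^+` in `ℝⁿ`: the vectors whose coordinates are either all integers or all
half-odd integers (elements of `ℤ + 1/2`), and whose coordinate sum is an even integer. -/
def latticeDPlus (n : ℕ) : Submodule ℤ (EuclideanSpace ℝ (Fin n)) where
  carrier := {x | ((∀ i, ∃ k : ℤ, x i = k) ∨ (∀ i, ∃ k : ℤ, x i = k + 1 / 2)) ∧
    ∃ m : ℤ, ∑ i, x i = 2 * m}
  zero_mem' := ⟨Or.inl fun _ => ⟨0, by simp⟩, 0, by simp⟩
  add_mem' := by
    rintro x y ⟨hx, a, ha⟩ ⟨hy, b, hb⟩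
    refine ⟨?_, a + b, ?_⟩
    · rcases hx with hx | hx <;> rcases hy with hy | hy
      · refine Or.inl fun i => ?_
        obtain ⟨k, hk⟩ := hx i
        obtain ⟨l, hl⟩ := hy i
        exact ⟨k + l, by simp [hk, hl]⟩
      · refine Or.inr fun i => ?_
        obtain ⟨k, hk⟩ := hx i
        obtain ⟨l, hl⟩ := hy i
        exact ⟨k + l, by simp [hk, hl]; ring⟩
      · refine Or.inr fun i => ?_
        obtain ⟨k, hk⟩ := hx i
        obtain ⟨l, hl⟩ := hy i
        exact ⟨k + l, by simp [hk, hl]; ring⟩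
      · refine Or.inl fun i => ?_
        obtain ⟨k, hk⟩ := hx i
        obtain ⟨l, hl⟩ := hy i
        exact ⟨k + l + 1, by simp [hk, hl]; ring⟩
    · simp [Finset.sum_add_distrib, ha, hb]; ring
  smul_mem' := by
    rintro c x ⟨hx, a, ha⟩
    refine ⟨?_, c * a, ?_⟩
    · rcases hx with hx | hx
      · refine Or.inl fun i => ?_
        obtain ⟨k, hk⟩ := hx i
        exact ⟨c * k, by simp [hk]⟩
      · rcases Int.even_or_odd' c with ⟨d, rfl | rfl⟩
        · refine Or.inl fun i => ?_
          obtain ⟨k, hk⟩ := hx i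
          exact ⟨2 * d * k + d, by simp [hk]; ring⟩
        · refine Or.inr fun i => ?_
          obtain ⟨k, hk⟩ := hx i
          exact ⟨(2 * d + 1) * k + d, by simp [hk]; ring⟩
    · simp [← Finset.mul_sum, ha]; ring

/-- The lattice `E_8`, in its even coordinate system. -/
def latticeE8 : Submodule ℤ (EuclideanSpace ℝ (Fin 8)) := latticeDPlus 8

/-- The lattice `D_16^+`. -/
def latticeD16Plus : Submodule ℤ (EuclideanSpace ℝ (Fin 16)) := latticeDPlus 16

/-- The lattice `E_8^2 = E_8 ⊕ E_8`, an orthogonal direct sum, in the orthogonal direct sum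
`ℝ⁸ ⊕ ℝ⁸` (the `L²` product). -/
def latticeE8Sq :
    Submodule ℤ (WithLp 2 (EuclideanSpace ℝ (Fin 8) × EuclideanSpace ℝ (Fin 8))) :=
  (latticeE8.prod latticeE8).comap
    (WithLp.linearEquiv 2 ℤ (EuclideanSpace ℝ (Fin 8) × EuclideanSpace ℝ (Fin 8))).toLinearMap

/-- The embeddings of `L`, an abelian group with the form `B`, into a lattice `Λ` of a Euclidean
space: the injective homomorphisms that carry `B` to the inner product. -/
def LatticeEmbedding {L V : Type*} [AddCommGroup L] [NormedAddCommGroup V]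
    [InnerProductSpace ℝ V] (B : L →ₗ[ℤ] L →ₗ[ℤ] ℝ) (Λ : Submodule ℤ V) : Type _ :=
  {f : L →ₗ[ℤ] Λ // Function.Injective f ∧ ∀ x y, inner ℝ (f x : V) (f y : V) = B x y}

end

/-! ### Polynomial identities in squared variables -/

section ThetaPolynomials

variable {K : Type*} [CommRing K]

/-! An embedding of `L` amounts to a triple of images of three generators with prescribed Gram
matrix, so the claim is that the degree 3 theta series of the two lattices coincide. These are
handled as formal power series: vectors are doubled to become integral, and the Gram matrix is
recorded by the squares `(z i + z j) ^ 2`, which are natural numbers even when inner products are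
negative. No analysis is needed.

Let θ_m run over the 64 theta constants of degree 3. For n > 0 divisible by 4, the sum of the θ_m ^
n is 8 times the theta series of D_n^+ (`sum_thetaSeries_pow`), so the claim is that the Schottky
form 8 Σ θ_m^16 − (Σ θ_m^8)^2 vanishes. By the duplication formula (`thetaSeries_sq`) each θ_m^2 is
a quadratic form in the eight second order theta constants. With these replaced by independent
variables, `schottky_identity` writes the Schottky form as 336 times r₀⁴ + r₁⁴ + r₂⁴ − 2(r₀²r₁² +
r₀²r₂² + r₁²r₂²), where each r_i² is a product of four of the forms. This Heron expression is
divisible by r₀ − r₁ − r₂.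

For theta constants, r_i is itself a product of four θ_m, and `riemann_relation` says r₀ = r₁ + r₂.
It comes from triality for D_4: half the Hadamard matrix of order 4 exchanges the vector class with
a spinor class and preserves the root lattice. -/

/-- The part of `(w + x + y + z) ^ 4` invariant under even sign changes, in terms of the squares
`a, b, c, d` of the variables and of their product `p`. -/
def evenQuartic (a b c d p : K) : K :=
  a ^ 2 + b ^ 2 + c ^ 2 + d ^ 2 + 6 * (a * b + a * c + a * d + b * c + b * d + c * d) + 24 * p

/-- The part of `(w + x + y + z) ^ 8` invariant under even sign changes, in terms of the squares
`a, b, c, d` of the variables and of their product `p`. -/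
def evenOctic (a b c d p : K) : K :=
  a ^ 4 + b ^ 4 + c ^ 4 + d ^ 4 +
  28 * (a ^ 3 * (b + c + d) + b ^ 3 * (a + c + d) + c ^ 3 * (a + b + d) + d ^ 3 * (a + b + c)) +
  70 * (a ^ 2 * b ^ 2 + a ^ 2 * c ^ 2 + a ^ 2 * d ^ 2 + b ^ 2 * c ^ 2 + b ^ 2 * d ^ 2 +
    c ^ 2 * d ^ 2) +
  420 * (a ^ 2 * (b * c + b * d + c * d) + b ^ 2 * (a * c + a * d + c * d) +
    c ^ 2 * (a * b + a * d + b * d) + d ^ 2 * (a * b + a * c + b * c)) + 2520 * (a * b * c * d) +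
  p * (336 * (a ^ 2 + b ^ 2 + c ^ 2 + d ^ 2) +
    1120 * (a * b + a * c + a * d + b * c + b * d + c * d))

/-- The product of the four forms `w ± x ± y ± z` with an even number of minus signs, in terms of
the squares `a, b, c, d` of the variables and of their product `p`. -/
def signProduct (a b c d p : K) : K :=
  a ^ 2 + b ^ 2 + c ^ 2 + d ^ 2 - 2 * (a * b + a * c + a * d + b * c + b * d + c * d) + 8 * p

/-- Half of `(x + y) ^ 8 + (x - y) ^ 8`, in terms of the squares of the variables. -/
def pairOctic (y z : K) : K :=
  y ^ 4 + 28 * y ^ 3 * z + 70 * y ^ 2 * z ^ 2 + 28 * y * z ^ 3 + z ^ 4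

/-- The part of `pairOctic (s + d + p) (s' + d' + p')` invariant under sign changes of `(d, d')`
and of `(p, p')`, in terms of the squares of the six variables and of the products
`s * s'`, `d * d'`, `p * p'`. -/
def evenPairOctic (a b e a' b' e' S D P : K) : K :=
  a ^ 2 + b ^ 2 + e ^ 2 + 6 * (a * b + a * e + b * e) +
  (a' ^ 2 + b' ^ 2 + e' ^ 2 + 6 * (a' * b' + a' * e' + b' * e')) +
  28 * (S * (a + 3 * b + 3 * e) + D * (b + 3 * a + 3 * e) + P * (e + 3 * a + 3 * b)) +
  28 * (S * (a' + 3 * b' + 3 * e') + D * (b' + 3 * a' + 3 * e') + P * (e' + 3 * a' + 3 * b')) +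
  70 * ((a + b + e) * (a' + b' + e') + 4 * (S * D + S * P + D * P))

theorem sum_signs_pow_four (w x y z : K) :
    (w + x + y + z) ^ 4 + (w - x + y - z) ^ 4 + (w + x - y - z) ^ 4 + (w - x - y + z) ^ 4 =
      4 * evenQuartic (w ^ 2) (x ^ 2) (y ^ 2) (z ^ 2) (w * x * y * z) := by
  unfold evenQuartic; ring

theorem sum_signs_pow_eight (w x y z : K) :
    (w + x + y + z) ^ 8 + (w - x + y - z) ^ 8 + (w + x - y - z) ^ 8 + (w - x - y + z) ^ 8 =
      4 * evenOctic (w ^ 2) (x ^ 2) (y ^ 2) (z ^ 2) (w * x * y * z) := by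
  unfold evenOctic; ring

theorem prod_signs (w x y z : K) :
    (w + x + y + z) * (w - x + y - z) * (w + x - y - z) * (w - x - y + z) =
      signProduct (w ^ 2) (x ^ 2) (y ^ 2) (z ^ 2) (w * x * y * z) := by
  unfold signProduct; ring

theorem sum_signs_pairOctic (s d p s' d' p' : K) :
    pairOctic (s + d + p) (s' + d' + p') + pairOctic (s + d - p) (s' + d' - p') +
      pairOctic (s - d + p) (s' - d' + p') + pairOctic (s - d - p) (s' - d' - p') =
    4 * evenPairOctic (s ^ 2) (d ^ 2) (p ^ 2) (s' ^ 2) (d' ^ 2) (p' ^ 2)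
      (s * s') (d * d') (p * p') := by
  unfold pairOctic evenPairOctic; ring

/-- The Schottky form in its reduced variables. The only relations needed are `a = b + e`, a
Pythagorean identity that plays the role of Jacobi's θ₀₀⁴ = θ₀₁⁴ + θ₁₀⁴, and the values of `S ^ 2`,
`D ^ 2`, `P ^ 2`. -/
theorem octic_core (b₀ b₁ b₂ b₃ e₀ e₁ e₂ e₃ S D P a₀ a₁ a₂ a₃ : K)
    (h₀ : a₀ = b₀ + e₀) (h₁ : a₁ = b₁ + e₁) (h₂ : a₂ = b₂ + e₂) (h₃ : a₃ = b₃ + e₃)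
    (hS : S ^ 2 = a₀ * a₁ * a₂ * a₃) (hD : D ^ 2 = b₀ * b₁ * b₂ * b₃)
    (hP : P ^ 2 = e₀ * e₁ * e₂ * e₃) :
    8 * (4 * (evenOctic a₀ a₁ a₂ a₃ S + evenOctic b₀ b₁ b₂ b₃ D + evenOctic e₀ e₁ e₂ e₃ P) +
      128 * (evenPairOctic (a₀ * a₁) (b₀ * b₁) (e₀ * e₁) (a₂ * a₃) (b₂ * b₃) (e₂ * e₃) S D P +
        evenPairOctic (a₀ * a₂) (b₀ * b₂) (e₀ * e₂) (a₁ * a₃) (b₁ * b₃) (e₁ * e₃) S D P +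
        evenPairOctic (a₀ * a₃) (b₀ * b₃) (e₀ * e₃) (a₁ * a₂) (b₁ * b₂) (e₁ * e₂) S D P)) -
      (4 * (evenQuartic a₀ a₁ a₂ a₃ S + evenQuartic b₀ b₁ b₂ b₃ D + evenQuartic e₀ e₁ e₂ e₃ P) +
      32 * ((a₀ * a₁ + b₀ * b₁ + e₀ * e₁ + a₂ * a₃ + b₂ * b₃ + e₂ * e₃) +
        (a₀ * a₂ + b₀ * b₂ + e₀ * e₂ + a₁ * a₃ + b₁ * b₃ + e₁ * e₃) +
        (a₀ * a₃ + b₀ * b₃ + e₀ * e₃ + a₁ * a₂ + b₁ * b₂ + e₁ * e₂) + 18 * (S + D + P))) ^ 2 =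
    336 * (signProduct a₀ a₁ a₂ a₃ S ^ 2 + signProduct b₀ b₁ b₂ b₃ D ^ 2 +
      signProduct e₀ e₁ e₂ e₃ P ^ 2 - 2 * (signProduct a₀ a₁ a₂ a₃ S * signProduct b₀ b₁ b₂ b₃ D +
      signProduct a₀ a₁ a₂ a₃ S * signProduct e₀ e₁ e₂ e₃ P +
      signProduct b₀ b₁ b₂ b₃ D * signProduct e₀ e₁ e₂ e₃ P)) := by
  subst h₀ h₁ h₂ h₃
  unfold evenOctic evenPairOctic evenQuartic signProduct
  -- The coefficient of `S ^ 2` in the difference of the sides: `S` enters the squared quartic with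
  -- coefficient 4 * 24 + 32 * 18 = 672, and `signProduct` with coefficient 8. The same holds for
  -- `D` and `P`.
  linear_combination (-672 ^ 2 - 336 * 64) * (hS + hD + hP)

end ThetaPolynomials

/-! ### Quadratic forms attached to pairs of characteristics -/

section ThetaPolynomials

variable {K : Type*} [CommRing K]

/-- The sign `(-1) ^ (b * (c + a))` attached to a characteristic `(a, b)` and a class `c`. -/
def charSign (m : Fin 2 × Fin 2) (c : Fin 2) : ℤ := (-1) ^ ((m.2 * (c + m.1) : Fin 2) : ℕ)

theorem two_mul_add_pow_eight (A A' Z Z' : K) (h : 2 * A ^ 2 = Z) (h' : 2 * A' ^ 2 = Z') :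
    (2 * (A + A')) ^ 8 + (2 * (A - A')) ^ 8 = 32 * pairOctic Z Z' := by
  subst h h'; unfold pairOctic; ring

/-- A quadratic form attached to a pair of characteristics, for a bilinear pairing `G`. -/
def charForm (G : Fin 2 → Fin 2 → Fin 2 → Fin 2 → K) (m n : Fin 2 × Fin 2) : K :=
  ∑ b, ∑ c, ((charSign m b * charSign n c : ℤ) : K) * G b c (b + m.1) (c + n.1)

/-- For symmetric `G` the terms of an odd pair of characteristics cancel in twos. Of the ten even
pairs, four give signed sums of the diagonal values, and the other six have their terms equal in
twos, whence the factors 2. -/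
theorem sum_charForm_pow_eight (G : Fin 2 → Fin 2 → Fin 2 → Fin 2 → K)
    (hG : ∀ b c b' c', G b c b' c' = G b' c' b c) :
    ∑ m, ∑ n, charForm G m n ^ 8 =
      ((G 0 0 0 0 + G 0 1 0 1 + G 1 0 1 0 + G 1 1 1 1) ^ 8 +
      (G 0 0 0 0 - G 0 1 0 1 + G 1 0 1 0 - G 1 1 1 1) ^ 8 +
      (G 0 0 0 0 + G 0 1 0 1 - G 1 0 1 0 - G 1 1 1 1) ^ 8 +
      (G 0 0 0 0 - G 0 1 0 1 - G 1 0 1 0 + G 1 1 1 1) ^ 8) +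
      ((2 * (G 0 0 0 1 + G 1 0 1 1)) ^ 8 + (2 * (G 0 0 0 1 - G 1 0 1 1)) ^ 8) +
      ((2 * (G 0 0 1 0 + G 0 1 1 1)) ^ 8 + (2 * (G 0 0 1 0 - G 0 1 1 1)) ^ 8) +
      ((2 * (G 0 0 1 1 + G 0 1 1 0)) ^ 8 + (2 * (G 0 0 1 1 - G 0 1 1 0)) ^ 8) := by
  simp [charForm, Fin.sum_univ_two, Fintype.sum_prod_type, charSign, hG 0 1 0 0, hG 1 0 0 0,
    hG 1 1 0 0, hG 1 0 0 1, hG 1 1 1 0, hG 1 1 0 1]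
  ring

theorem sum_charForm_pow_four (G : Fin 2 → Fin 2 → Fin 2 → Fin 2 → K)
    (hG : ∀ b c b' c', G b c b' c' = G b' c' b c) :
    ∑ m, ∑ n, charForm G m n ^ 4 =
      ((G 0 0 0 0 + G 0 1 0 1 + G 1 0 1 0 + G 1 1 1 1) ^ 4 +
      (G 0 0 0 0 - G 0 1 0 1 + G 1 0 1 0 - G 1 1 1 1) ^ 4 +
      (G 0 0 0 0 + G 0 1 0 1 - G 1 0 1 0 - G 1 1 1 1) ^ 4 +
      (G 0 0 0 0 - G 0 1 0 1 - G 1 0 1 0 + G 1 1 1 1) ^ 4) +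
      ((2 * (G 0 0 0 1 + G 1 0 1 1)) ^ 4 + (2 * (G 0 0 0 1 - G 1 0 1 1)) ^ 4) +
      ((2 * (G 0 0 1 0 + G 0 1 1 1)) ^ 4 + (2 * (G 0 0 1 0 - G 0 1 1 1)) ^ 4) +
      ((2 * (G 0 0 1 1 + G 0 1 1 0)) ^ 4 + (2 * (G 0 0 1 1 - G 0 1 1 0)) ^ 4) := by
  simp [charForm, Fin.sum_univ_two, Fintype.sum_prod_type, charSign, hG 0 1 0 0, hG 1 0 0 0,
    hG 1 1 0 0, hG 1 0 0 1, hG 1 1 1 0, hG 1 1 0 1]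
  ring

/-- Antisymmetry reverses the roles: the even pairs of characteristics vanish and the six odd ones
remain. -/
theorem sum_charForm_pow_eight_of_antisymm (G : Fin 2 → Fin 2 → Fin 2 → Fin 2 → K)
    (hG : ∀ b c b' c', G b c b' c' = - G b' c' b c) (h0 : ∀ b c, G b c b c = 0) :
    ∑ m, ∑ n, charForm G m n ^ 8 =
      ((2 * (G 0 0 0 1 + G 1 0 1 1)) ^ 8 + (2 * (G 0 0 0 1 - G 1 0 1 1)) ^ 8) +
      ((2 * (G 0 0 1 0 + G 0 1 1 1)) ^ 8 + (2 * (G 0 0 1 0 - G 0 1 1 1)) ^ 8) +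
      ((2 * (G 0 0 1 1 + G 0 1 1 0)) ^ 8 + (2 * (G 0 0 1 1 - G 0 1 1 0)) ^ 8) := by
  simp [charForm, Fin.sum_univ_two, Fintype.sum_prod_type, charSign, hG 0 1 0 0, hG 1 0 0 0,
    hG 1 1 0 0, hG 1 0 0 1, hG 1 1 1 0, hG 1 1 0 1, h0]
  ring

theorem sum_charForm_pow_four_of_antisymm (G : Fin 2 → Fin 2 → Fin 2 → Fin 2 → K)
    (hG : ∀ b c b' c', G b c b' c' = - G b' c' b c) (h0 : ∀ b c, G b c b c = 0) :
    ∑ m, ∑ n, charForm G m n ^ 4 =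
      ((2 * (G 0 0 0 1 + G 1 0 1 1)) ^ 4 + (2 * (G 0 0 0 1 - G 1 0 1 1)) ^ 4) +
      ((2 * (G 0 0 1 0 + G 0 1 1 1)) ^ 4 + (2 * (G 0 0 1 0 - G 0 1 1 1)) ^ 4) +
      ((2 * (G 0 0 1 1 + G 0 1 1 0)) ^ 4 + (2 * (G 0 0 1 1 - G 0 1 1 0)) ^ 4) := by
  simp [charForm, Fin.sum_univ_two, Fintype.sum_prod_type, charSign, hG 0 1 0 0, hG 1 0 0 0,
    hG 1 1 0 0, hG 1 0 0 1, hG 1 1 1 0, hG 1 1 0 1, h0]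
  ring

theorem prod_charForm (G : Fin 2 → Fin 2 → Fin 2 → Fin 2 → K) :
    charForm G (0, 0) (0, 0) * charForm G (0, 0) (0, 1) * charForm G (0, 1) (0, 0) *
      charForm G (0, 1) (0, 1) =
    signProduct (G 0 0 0 0 ^ 2) (G 0 1 0 1 ^ 2) (G 1 0 1 0 ^ 2) (G 1 1 1 1 ^ 2)
      (G 0 0 0 0 * G 0 1 0 1 * G 1 0 1 0 * G 1 1 1 1) := by
  rw [← prod_signs]
  simp [charForm, Fin.sum_univ_two, charSign]
  ring

end ThetaPolynomials

/-! ### Eight independent variables and the Schottky form -/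

section ThetaPolynomials

variable {K : Type*} [CommRing K]

/-- The bilinear pairing of the vectors `f · b c` and `f · b' c'` with a characteristic `l`. -/
def charPairing (f : Fin 2 → Fin 2 → Fin 2 → K) (l : Fin 2 × Fin 2) (b c b' c' : Fin 2) : K :=
  ∑ a, (charSign l a : K) * f a b c * f (a + l.1) b' c'

theorem charPairing_zero_zero (f : Fin 2 → Fin 2 → Fin 2 → K) (b c b' c' : Fin 2) :
    charPairing f (0, 0) b c b' c' = f 0 b c * f 0 b' c' + f 1 b c * f 1 b' c' := by
  simp [charPairing, charSign]

theorem charPairing_zero_one (f : Fin 2 → Fin 2 → Fin 2 → K) (b c b' c' : Fin 2) :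
    charPairing f (0, 1) b c b' c' = f 0 b c * f 0 b' c' - f 1 b c * f 1 b' c' := by
  simp [charPairing, charSign]; ring

theorem charPairing_one_zero (f : Fin 2 → Fin 2 → Fin 2 → K) (b c b' c' : Fin 2) :
    charPairing f (1, 0) b c b' c' = f 0 b c * f 1 b' c' + f 1 b c * f 0 b' c' := by
  simp [charPairing, charSign]

theorem charPairing_one_one (f : Fin 2 → Fin 2 → Fin 2 → K) (b c b' c' : Fin 2) :
    charPairing f (1, 1) b c b' c' = -(f 0 b c * f 1 b' c' - f 1 b c * f 0 b' c') := by
  simp [charPairing, charSign]; ring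

theorem charPairing_symm (f : Fin 2 → Fin 2 → Fin 2 → K) {l : Fin 2 × Fin 2} (hl : l ≠ (1, 1))
    (b c b' c' : Fin 2) : charPairing f l b c b' c' = charPairing f l b' c' b c := by
  obtain ⟨i, j⟩ := l
  fin_cases i <;> fin_cases j
  · simp only [Fin.zero_eta, charPairing_zero_zero]; ring
  · simp only [Fin.zero_eta, Fin.mk_one, charPairing_zero_one]; ring
  · simp only [Fin.zero_eta, Fin.mk_one, charPairing_one_zero]; ring
  · exact absurd rfl hl

theorem charPairing_antisymm (f : Fin 2 → Fin 2 → Fin 2 → K) (b c b' c' : Fin 2) :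
    charPairing f (1, 1) b c b' c' = -charPairing f (1, 1) b' c' b c := by
  simp only [charPairing_one_one]; ring

theorem charPairing_self (f : Fin 2 → Fin 2 → Fin 2 → K) (b c : Fin 2) :
    charPairing f (1, 1) b c b c = 0 := by
  simp only [charPairing_one_one]; ring

/-- The sum of the squares of the two coordinates of `f · b c`. -/
def sqAdd (f : Fin 2 → Fin 2 → Fin 2 → K) (b c : Fin 2) : K := f 0 b c ^ 2 + f 1 b c ^ 2

/-- The difference of the squares of the two coordinates of `f · b c`. -/
def sqSub (f : Fin 2 → Fin 2 → Fin 2 → K) (b c : Fin 2) : K := f 0 b c ^ 2 - f 1 b c ^ 2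

/-- Twice the product of the two coordinates of `f · b c`. -/
def twoMul (f : Fin 2 → Fin 2 → Fin 2 → K) (b c : Fin 2) : K := 2 * f 0 b c * f 1 b c

theorem charPairing_zero_zero_self (f : Fin 2 → Fin 2 → Fin 2 → K) (b c : Fin 2) :
    charPairing f (0, 0) b c b c = sqAdd f b c := by
  rw [charPairing_zero_zero, sqAdd]; ring

theorem charPairing_zero_one_self (f : Fin 2 → Fin 2 → Fin 2 → K) (b c : Fin 2) :
    charPairing f (0, 1) b c b c = sqSub f b c := by
  rw [charPairing_zero_one, sqSub]; ring

theorem charPairing_one_zero_self (f : Fin 2 → Fin 2 → Fin 2 → K) (b c : Fin 2) :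
    charPairing f (1, 0) b c b c = twoMul f b c := by
  rw [charPairing_one_zero, twoMul]; ring

/-- Twice the square of a pairing is `s ± d ± p`, with `s`, `d`, `p` the products of the two values
of `sqAdd`, `sqSub`, `twoMul`; the four characteristics `l` realize the four sign choices. Summing
over `l` therefore keeps only the part invariant under sign changes. -/
theorem sum_charPairing_pow_eight (f : Fin 2 → Fin 2 → Fin 2 → K)
    (b₀ c₀ b₁ c₁ b₂ c₂ b₃ c₃ : Fin 2) {S D P : K}
    (hS : sqAdd f b₀ c₀ * sqAdd f b₁ c₁ * (sqAdd f b₂ c₂ * sqAdd f b₃ c₃) = S)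
    (hD : sqSub f b₀ c₀ * sqSub f b₁ c₁ * (sqSub f b₂ c₂ * sqSub f b₃ c₃) = D)
    (hP : twoMul f b₀ c₀ * twoMul f b₁ c₁ * (twoMul f b₂ c₂ * twoMul f b₃ c₃) = P) :
    ∑ l, ((2 * (charPairing f l b₀ c₀ b₁ c₁ + charPairing f l b₂ c₂ b₃ c₃)) ^ 8 +
      (2 * (charPairing f l b₀ c₀ b₁ c₁ - charPairing f l b₂ c₂ b₃ c₃)) ^ 8) =
    128 * evenPairOctic
      (sqAdd f b₀ c₀ ^ 2 * sqAdd f b₁ c₁ ^ 2) (sqSub f b₀ c₀ ^ 2 * sqSub f b₁ c₁ ^ 2)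
        (twoMul f b₀ c₀ ^ 2 * twoMul f b₁ c₁ ^ 2)
      (sqAdd f b₂ c₂ ^ 2 * sqAdd f b₃ c₃ ^ 2) (sqSub f b₂ c₂ ^ 2 * sqSub f b₃ c₃ ^ 2)
        (twoMul f b₂ c₂ ^ 2 * twoMul f b₃ c₃ ^ 2) S D P := by
  rw [Fintype.sum_prod_type, Fin.sum_univ_two, Fin.sum_univ_two, Fin.sum_univ_two]
  subst hS hD hP
  have key := sum_signs_pairOctic (sqAdd f b₀ c₀ * sqAdd f b₁ c₁) (sqSub f b₀ c₀ * sqSub f b₁ c₁)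
    (twoMul f b₀ c₀ * twoMul f b₁ c₁) (sqAdd f b₂ c₂ * sqAdd f b₃ c₃)
    (sqSub f b₂ c₂ * sqSub f b₃ c₃) (twoMul f b₂ c₂ * twoMul f b₃ c₃)
  simp only [mul_pow] at key
  have sq₁ (b c b' c' : Fin 2) : 2 * charPairing f (0, 0) b c b' c' ^ 2 =
      sqAdd f b c * sqAdd f b' c' + sqSub f b c * sqSub f b' c' +
        twoMul f b c * twoMul f b' c' := by
    rw [charPairing_zero_zero]; unfold sqAdd sqSub twoMul; ring
  have sq₂ (b c b' c' : Fin 2) : 2 * charPairing f (0, 1) b c b' c' ^ 2 =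
      sqAdd f b c * sqAdd f b' c' + sqSub f b c * sqSub f b' c' -
        twoMul f b c * twoMul f b' c' := by
    rw [charPairing_zero_one]; unfold sqAdd sqSub twoMul; ring
  have sq₃ (b c b' c' : Fin 2) : 2 * charPairing f (1, 0) b c b' c' ^ 2 =
      sqAdd f b c * sqAdd f b' c' - sqSub f b c * sqSub f b' c' +
        twoMul f b c * twoMul f b' c' := by
    rw [charPairing_one_zero]; unfold sqAdd sqSub twoMul; ring
  have sq₄ (b c b' c' : Fin 2) : 2 * charPairing f (1, 1) b c b' c' ^ 2 =
      sqAdd f b c * sqAdd f b' c' - sqSub f b c * sqSub f b' c' -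
        twoMul f b c * twoMul f b' c' := by
    rw [charPairing_one_one]; unfold sqAdd sqSub twoMul; ring
  rw [two_mul_add_pow_eight _ _ _ _ (sq₁ _ _ _ _) (sq₁ _ _ _ _),
    two_mul_add_pow_eight _ _ _ _ (sq₂ _ _ _ _) (sq₂ _ _ _ _),
    two_mul_add_pow_eight _ _ _ _ (sq₃ _ _ _ _) (sq₃ _ _ _ _),
    two_mul_add_pow_eight _ _ _ _ (sq₄ _ _ _ _) (sq₄ _ _ _ _)]
  linear_combination 32 * key

theorem sum_charPairing_pow_four (f : Fin 2 → Fin 2 → Fin 2 → K)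
    (b₀ c₀ b₁ c₁ b₂ c₂ b₃ c₃ : Fin 2) {S D P : K}
    (hS : sqAdd f b₀ c₀ * sqAdd f b₁ c₁ * (sqAdd f b₂ c₂ * sqAdd f b₃ c₃) = S)
    (hD : sqSub f b₀ c₀ * sqSub f b₁ c₁ * (sqSub f b₂ c₂ * sqSub f b₃ c₃) = D)
    (hP : twoMul f b₀ c₀ * twoMul f b₁ c₁ * (twoMul f b₂ c₂ * twoMul f b₃ c₃) = P) :
    ∑ l, ((2 * (charPairing f l b₀ c₀ b₁ c₁ + charPairing f l b₂ c₂ b₃ c₃)) ^ 4 +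
      (2 * (charPairing f l b₀ c₀ b₁ c₁ - charPairing f l b₂ c₂ b₃ c₃)) ^ 4) =
    32 * (sqAdd f b₀ c₀ ^ 2 * sqAdd f b₁ c₁ ^ 2 + sqSub f b₀ c₀ ^ 2 * sqSub f b₁ c₁ ^ 2 +
      twoMul f b₀ c₀ ^ 2 * twoMul f b₁ c₁ ^ 2 +
      sqAdd f b₂ c₂ ^ 2 * sqAdd f b₃ c₃ ^ 2 + sqSub f b₂ c₂ ^ 2 * sqSub f b₃ c₃ ^ 2 +
        twoMul f b₂ c₂ ^ 2 * twoMul f b₃ c₃ ^ 2 + 6 * (S + D + P)) := by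
  rw [Fintype.sum_prod_type, Fin.sum_univ_two, Fin.sum_univ_two, Fin.sum_univ_two]
  subst hS hD hP
  simp only [charPairing_zero_zero, charPairing_zero_one, charPairing_one_zero,
    charPairing_one_one, sqAdd, sqSub, twoMul]
  ring

/-- The three even `l` contribute the diagonal terms, with values `sqAdd`, `sqSub`, `twoMul`. The
off-diagonal terms, to which all four `l` contribute, correspond to the three splittings of the four
classes `(b, c)` into two pairs. -/
theorem sum_charForm_charPairing_pow_eight (f : Fin 2 → Fin 2 → Fin 2 → K) {S D P : K}
    (hS : sqAdd f 0 0 * sqAdd f 0 1 * sqAdd f 1 0 * sqAdd f 1 1 = S)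
    (hD : sqSub f 0 0 * sqSub f 0 1 * sqSub f 1 0 * sqSub f 1 1 = D)
    (hP : twoMul f 0 0 * twoMul f 0 1 * twoMul f 1 0 * twoMul f 1 1 = P) :
    ∑ l, ∑ m, ∑ n, charForm (charPairing f l) m n ^ 8 =
      4 * (evenOctic (sqAdd f 0 0 ^ 2) (sqAdd f 0 1 ^ 2) (sqAdd f 1 0 ^ 2) (sqAdd f 1 1 ^ 2) S +
      evenOctic (sqSub f 0 0 ^ 2) (sqSub f 0 1 ^ 2) (sqSub f 1 0 ^ 2) (sqSub f 1 1 ^ 2) D +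
      evenOctic (twoMul f 0 0 ^ 2) (twoMul f 0 1 ^ 2) (twoMul f 1 0 ^ 2) (twoMul f 1 1 ^ 2) P) +
      128 * (evenPairOctic (sqAdd f 0 0 ^ 2 * sqAdd f 0 1 ^ 2) (sqSub f 0 0 ^ 2 * sqSub f 0 1 ^ 2)
        (twoMul f 0 0 ^ 2 * twoMul f 0 1 ^ 2)
        (sqAdd f 1 0 ^ 2 * sqAdd f 1 1 ^ 2) (sqSub f 1 0 ^ 2 * sqSub f 1 1 ^ 2)
        (twoMul f 1 0 ^ 2 * twoMul f 1 1 ^ 2) S D P +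
      evenPairOctic (sqAdd f 0 0 ^ 2 * sqAdd f 1 0 ^ 2) (sqSub f 0 0 ^ 2 * sqSub f 1 0 ^ 2)
        (twoMul f 0 0 ^ 2 * twoMul f 1 0 ^ 2)
        (sqAdd f 0 1 ^ 2 * sqAdd f 1 1 ^ 2) (sqSub f 0 1 ^ 2 * sqSub f 1 1 ^ 2)
        (twoMul f 0 1 ^ 2 * twoMul f 1 1 ^ 2) S D P +
      evenPairOctic (sqAdd f 0 0 ^ 2 * sqAdd f 1 1 ^ 2) (sqSub f 0 0 ^ 2 * sqSub f 1 1 ^ 2)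
        (twoMul f 0 0 ^ 2 * twoMul f 1 1 ^ 2)
        (sqAdd f 0 1 ^ 2 * sqAdd f 1 0 ^ 2) (sqSub f 0 1 ^ 2 * sqSub f 1 0 ^ 2)
        (twoMul f 0 1 ^ 2 * twoMul f 1 0 ^ 2) S D P) := by
  have h₁ := sum_charPairing_pow_eight f 0 0 0 1 1 0 1 1 (S := S) (D := D) (P := P)
    (by rw [← hS]; ring) (by rw [← hD]; ring) (by rw [← hP]; ring)
  have h₂ := sum_charPairing_pow_eight f 0 0 1 0 0 1 1 1 (S := S) (D := D) (P := P)
    (by rw [← hS]; ring) (by rw [← hD]; ring) (by rw [← hP]; ring)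
  have h₃ := sum_charPairing_pow_eight f 0 0 1 1 0 1 1 0 (S := S) (D := D) (P := P)
    (by rw [← hS]; ring) (by rw [← hD]; ring) (by rw [← hP]; ring)
  rw [Fintype.sum_prod_type, Fin.sum_univ_two, Fin.sum_univ_two, Fin.sum_univ_two] at h₁ h₂ h₃ ⊢
  rw [sum_charForm_pow_eight _ (charPairing_symm f (by decide)),
    sum_charForm_pow_eight _ (charPairing_symm f (by decide)),
    sum_charForm_pow_eight _ (charPairing_symm f (by decide)),
    sum_charForm_pow_eight_of_antisymm _ (charPairing_antisymm f) (charPairing_self f)]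
  simp only [charPairing_zero_zero_self, charPairing_zero_one_self, charPairing_one_zero_self,
    sum_signs_pow_eight, hS, hD, hP]
  linear_combination h₁ + h₂ + h₃

theorem sum_charForm_charPairing_pow_four (f : Fin 2 → Fin 2 → Fin 2 → K) {S D P : K}
    (hS : sqAdd f 0 0 * sqAdd f 0 1 * sqAdd f 1 0 * sqAdd f 1 1 = S)
    (hD : sqSub f 0 0 * sqSub f 0 1 * sqSub f 1 0 * sqSub f 1 1 = D)
    (hP : twoMul f 0 0 * twoMul f 0 1 * twoMul f 1 0 * twoMul f 1 1 = P) :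
    ∑ l, ∑ m, ∑ n, charForm (charPairing f l) m n ^ 4 =
      4 * (evenQuartic (sqAdd f 0 0 ^ 2) (sqAdd f 0 1 ^ 2) (sqAdd f 1 0 ^ 2) (sqAdd f 1 1 ^ 2) S +
      evenQuartic (sqSub f 0 0 ^ 2) (sqSub f 0 1 ^ 2) (sqSub f 1 0 ^ 2) (sqSub f 1 1 ^ 2) D +
      evenQuartic (twoMul f 0 0 ^ 2) (twoMul f 0 1 ^ 2) (twoMul f 1 0 ^ 2) (twoMul f 1 1 ^ 2) P) +
      32 * ((sqAdd f 0 0 ^ 2 * sqAdd f 0 1 ^ 2 + sqSub f 0 0 ^ 2 * sqSub f 0 1 ^ 2 +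
        twoMul f 0 0 ^ 2 * twoMul f 0 1 ^ 2 +
        sqAdd f 1 0 ^ 2 * sqAdd f 1 1 ^ 2 + sqSub f 1 0 ^ 2 * sqSub f 1 1 ^ 2 +
          twoMul f 1 0 ^ 2 * twoMul f 1 1 ^ 2) +
      (sqAdd f 0 0 ^ 2 * sqAdd f 1 0 ^ 2 + sqSub f 0 0 ^ 2 * sqSub f 1 0 ^ 2 +
        twoMul f 0 0 ^ 2 * twoMul f 1 0 ^ 2 +
        sqAdd f 0 1 ^ 2 * sqAdd f 1 1 ^ 2 + sqSub f 0 1 ^ 2 * sqSub f 1 1 ^ 2 +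
          twoMul f 0 1 ^ 2 * twoMul f 1 1 ^ 2) +
      (sqAdd f 0 0 ^ 2 * sqAdd f 1 1 ^ 2 + sqSub f 0 0 ^ 2 * sqSub f 1 1 ^ 2 +
        twoMul f 0 0 ^ 2 * twoMul f 1 1 ^ 2 +
        sqAdd f 0 1 ^ 2 * sqAdd f 1 0 ^ 2 + sqSub f 0 1 ^ 2 * sqSub f 1 0 ^ 2 +
          twoMul f 0 1 ^ 2 * twoMul f 1 0 ^ 2) +
      18 * (S + D + P)) := by
  have h₁ := sum_charPairing_pow_four f 0 0 0 1 1 0 1 1 (S := S) (D := D) (P := P)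
    (by rw [← hS]; ring) (by rw [← hD]; ring) (by rw [← hP]; ring)
  have h₂ := sum_charPairing_pow_four f 0 0 1 0 0 1 1 1 (S := S) (D := D) (P := P)
    (by rw [← hS]; ring) (by rw [← hD]; ring) (by rw [← hP]; ring)
  have h₃ := sum_charPairing_pow_four f 0 0 1 1 0 1 1 0 (S := S) (D := D) (P := P)
    (by rw [← hS]; ring) (by rw [← hD]; ring) (by rw [← hP]; ring)
  rw [Fintype.sum_prod_type, Fin.sum_univ_two, Fin.sum_univ_two, Fin.sum_univ_two] at h₁ h₂ h₃ ⊢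
  rw [sum_charForm_pow_four _ (charPairing_symm f (by decide)),
    sum_charForm_pow_four _ (charPairing_symm f (by decide)),
    sum_charForm_pow_four _ (charPairing_symm f (by decide)),
    sum_charForm_pow_four_of_antisymm _ (charPairing_antisymm f) (charPairing_self f)]
  simp only [charPairing_zero_zero_self, charPairing_zero_one_self, charPairing_one_zero_self,
    sum_signs_pow_four, hS, hD, hP]
  linear_combination h₁ + h₂ + h₃

/-- When each `R l` is a square, the right side is Heron's expression in the square roots, so one
linear relation between these makes the Schottky form vanish. -/
theorem schottky_identity (f : Fin 2 → Fin 2 → Fin 2 → K) (R : Fin 2 × Fin 2 → K)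
    (hR : ∀ l, R l = charForm (charPairing f l) (0, 0) (0, 0) *
      charForm (charPairing f l) (0, 0) (0, 1) * charForm (charPairing f l) (0, 1) (0, 0) *
      charForm (charPairing f l) (0, 1) (0, 1)) :
    8 * ∑ l, ∑ m, ∑ n, charForm (charPairing f l) m n ^ 8 -
      (∑ l, ∑ m, ∑ n, charForm (charPairing f l) m n ^ 4) ^ 2 =
    336 * (R (0, 0) ^ 2 + R (0, 1) ^ 2 + R (1, 0) ^ 2 -
      2 * (R (0, 0) * R (0, 1) + R (0, 0) * R (1, 0) + R (0, 1) * R (1, 0))) := by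
  rw [sum_charForm_charPairing_pow_eight f rfl rfl rfl,
    sum_charForm_charPairing_pow_four f rfl rfl rfl, hR, hR, hR,
    prod_charForm, prod_charForm, prod_charForm]
  simp only [charPairing_zero_zero_self, charPairing_zero_one_self, charPairing_one_zero_self]
  have pyth : ∀ b c, sqAdd f b c ^ 2 = sqSub f b c ^ 2 + twoMul f b c ^ 2 := fun b c => by
    unfold sqAdd sqSub twoMul; ring
  exact octic_core _ _ _ _ _ _ _ _ _ _ _ _ _ _ _ (pyth 0 0) (pyth 0 1) (pyth 1 0) (pyth 1 1)
    (by simp only [mul_pow]) (by simp only [mul_pow]) (by simp only [mul_pow])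

end ThetaPolynomials

/-! ### Formal generating series of graded sets -/

section GeneratingSeries

variable {X Y σ ι : Type*}

/-- The formal series `∑ x, w x • T ^ (q x)`, for a degree map `q` with finite fibres. -/
noncomputable def genSeries (q : X → σ →₀ ℕ) (w : X → ℚ) : MvPowerSeries σ ℚ :=
  fun e => ∑ᶠ x, ∑ᶠ (_ : q x = e), w x

/-- A degree map has finite fibres. -/
def FiniteFibers (q : X → σ →₀ ℕ) : Prop := ∀ e, {x | q x = e}.Finite

theorem coeff_genSeries {q : X → σ →₀ ℕ} (hq : FiniteFibers q) (w : X → ℚ) (e : σ →₀ ℕ) :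
    MvPowerSeries.coeff e (genSeries q w) = ∑ x ∈ (hq e).toFinset, w x := by
  have : MvPowerSeries.coeff e (genSeries q w) = ∑ᶠ x, ∑ᶠ (_ : x ∈ {x | q x = e}), w x := rfl
  rw [this, finsum_mem_eq_finite_toFinset_sum _ (hq e)]

theorem FiniteFibers.finite_le {q : X → σ →₀ ℕ} (hq : FiniteFibers q) (e : σ →₀ ℕ) :
    {x | q x ≤ e}.Finite := by
  classical
  have : {x | q x ≤ e} = ⋃ e' ∈ Finset.Iic e, {x | q x = e'} := by
    ext x; simp
  rw [this]
  exact Set.Finite.biUnion (Finset.finite_toSet _) fun e' _ => hq e'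

theorem FiniteFibers.prod {q : X → σ →₀ ℕ} {r : Y → σ →₀ ℕ} (hq : FiniteFibers q)
    (hr : FiniteFibers r) : FiniteFibers fun p : X × Y => q p.1 + r p.2 := by
  intro e
  refine ((hq.finite_le e).prod (hr.finite_le e)).subset ?_
  rintro ⟨x, y⟩ (h : q x + r y = e)
  subst h
  exact ⟨le_self_add (a := q x), le_add_self (a := r y)⟩

theorem FiniteFibers.pi [Fintype ι] {q : X → σ →₀ ℕ} (hq : FiniteFibers q) :
    FiniteFibers fun x : ι → X => ∑ i, q (x i) := by
  intro e
  refine (Set.Finite.pi' fun _ : ι => hq.finite_le e).subset ?_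
  rintro x (h : ∑ i, q (x i) = e) i
  exact h ▸ Finset.single_le_sum (f := fun i => q (x i)) (fun _ _ => zero_le) (Finset.mem_univ i)

theorem genSeries_mul {q : X → σ →₀ ℕ} {r : Y → σ →₀ ℕ} (hq : FiniteFibers q)
    (hr : FiniteFibers r) (w : X → ℚ) (v : Y → ℚ) :
    genSeries q w * genSeries r v =
      genSeries (fun p : X × Y => q p.1 + r p.2) fun p => w p.1 * v p.2 := by
  classical
  ext e
  rw [MvPowerSeries.coeff_mul, coeff_genSeries (hq.prod hr),
    ← Finset.sum_fiberwise_of_maps_to (s := ((hq.prod hr) e).toFinset)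
      (t := Finset.HasAntidiagonal.antidiagonal e) (g := fun p => (q p.1, r p.2))]
  · refine Finset.sum_congr rfl fun ij hij => ?_
    rw [coeff_genSeries hq, coeff_genSeries hr, Finset.sum_mul_sum, ← Finset.sum_product']
    refine Finset.sum_congr ?_ fun _ _ => rfl
    ext ⟨x, y⟩
    rw [Finset.HasAntidiagonal.mem_antidiagonal] at hij
    simp only [Finset.mem_product, Set.Finite.mem_toFinset, Set.mem_ofPred_eq, Finset.mem_filter,
      Prod.ext_iff]
    constructor
    · rintro ⟨h, h'⟩
      exact ⟨by rw [h, h', hij], h, h'⟩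
    · exact fun h => h.2
  · intro p hp
    simpa using hp

/-- Only elements of nonzero weight count, so `i` and `j` need to be inverse only between the
supports. This permits maps defined by integer division that are meaningful only under parity
conditions. -/
theorem genSeries_congr {q : X → σ →₀ ℕ} {r : Y → σ →₀ ℕ} (hq : FiniteFibers q)
    (hr : FiniteFibers r) {w : X → ℚ} {v : Y → ℚ} (i : X → Y) (j : Y → X)
    (hi : ∀ x, w x ≠ 0 → r (i x) = q x ∧ v (i x) = w x ∧ j (i x) = x)
    (hj : ∀ y, v y ≠ 0 → w (j y) ≠ 0 ∧ i (j y) = y) : genSeries q w = genSeries r v := by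
  ext e
  rw [coeff_genSeries hq, coeff_genSeries hr]
  refine Finset.sum_bij_ne_zero (fun x _ _ => i x) ?_ ?_ ?_ ?_
  · intro x hx h
    simpa [(hi x h).1] using hx
  · intro x _ h y _ h' hxy
    rw [← (hi x h).2.2, hxy, (hi y h').2.2]
  · intro y hy h
    obtain ⟨h1, h2⟩ := hj y h
    refine ⟨j y, ?_, h1, h2⟩
    have := (hi _ h1).1
    rw [h2] at this
    simpa [← this] using hy
  · intro x _ h
    exact (hi x h).2.1.symm

theorem genSeries_sum {q : X → σ →₀ ℕ} (hq : FiniteFibers q) (s : Finset ι) (w : ι → X → ℚ) :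
    genSeries q (fun x => ∑ i ∈ s, w i x) = ∑ i ∈ s, genSeries q (w i) := by
  ext e
  simp only [map_sum, coeff_genSeries hq]
  exact Finset.sum_comm

theorem genSeries_add {q : X → σ →₀ ℕ} (hq : FiniteFibers q) (w v : X → ℚ) :
    genSeries q (fun x => w x + v x) = genSeries q w + genSeries q v := by
  ext e
  simp only [map_add, coeff_genSeries hq, Finset.sum_add_distrib]

theorem genSeries_intCast_mul {q : X → σ →₀ ℕ} (hq : FiniteFibers q) (c : ℤ) (w : X → ℚ) :
    genSeries q (fun x => c * w x) = c * genSeries q w := by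
  ext e
  rw [← zsmul_eq_mul, map_zsmul, coeff_genSeries hq, coeff_genSeries hq, ← Finset.mul_sum,
    zsmul_eq_mul]

theorem genSeries_pi {q : X → σ →₀ ℕ} (hq : FiniteFibers q) :
    ∀ {n : ℕ} (w : Fin n → X → ℚ), ∏ i, genSeries q (w i) =
      genSeries (fun x : Fin n → X => ∑ i, q (x i)) fun x => ∏ i, w i (x i)
  | 0, w => by
    classical
    ext e
    have hfin : FiniteFibers fun _ : Fin 0 → X => (0 : σ →₀ ℕ) := fun e => Set.toFinite _
    simp only [Finset.univ_eq_empty, Finset.prod_empty, Finset.sum_empty]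
    rw [coeff_genSeries hfin, MvPowerSeries.coeff_one]
    split_ifs with h
    · subst h
      simp
    · rw [Finset.sum_eq_zero]
      intro x hx
      rw [Set.Finite.mem_toFinset] at hx
      exact absurd (Eq.symm hx) h
  | n + 1, w => by
    rw [Fin.prod_univ_succ, genSeries_pi hq fun i => w i.succ, genSeries_mul hq hq.pi]
    refine genSeries_congr (hq.prod hq.pi) hq.pi (fun p => Fin.cons p.1 p.2)
      (fun x => (x 0, Fin.tail x)) ?_ ?_
    · rintro ⟨x, y⟩ _
      simp [Fin.sum_univ_succ, Fin.prod_univ_succ]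
    · intro x hx
      rw [Fin.prod_univ_succ] at hx
      exact ⟨hx, Fin.cons_self_tail x⟩

theorem coeff_genSeries_indicator {q : X → σ →₀ ℕ} (hq : FiniteFibers q) (p : X → Prop)
    [DecidablePred p] (e : σ →₀ ℕ) :
      MvPowerSeries.coeff e (genSeries q fun x => if p x then 1 else 0) =
      Nat.card {x // p x ∧ q x = e} := by
  rw [coeff_genSeries hq, Finset.sum_boole, Nat.subtype_card]
  intro x
  simp [and_comm]

end GeneratingSeries

/-! ### Theta constants of degree 3 and the duplication formula -/

section ThetaSeries

/-- The degree of an integer vector `z`: the family of the squares `(z i + z j) ^ 2`. -/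
noncomputable def gramDegree (z : Fin 3 → ℤ) : Fin 3 × Fin 3 →₀ ℕ :=
  Finsupp.equivFunOnFinite.symm fun p => (z p.1 + z p.2).natAbs ^ 2

theorem gramDegree_apply (z : Fin 3 → ℤ) (p : Fin 3 × Fin 3) :
    (gramDegree z p : ℤ) = (z p.1 + z p.2) ^ 2 := by
  simp [gramDegree]

theorem finiteFibers_of_diag {q : (Fin 3 → ℤ) → Fin 3 × Fin 3 →₀ ℕ}
    (hq : ∀ z i, z i ^ 2 ≤ q z (i, i)) : FiniteFibers q := by
  intro e
  -- The diagonal degrees alone bound `z`, since an integer with `k ^ 2 ≤ N` satisfies `|k| ≤ N`.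
  refine (Set.Finite.pi' (t := fun i => Set.Icc (-(e (i, i) : ℤ)) (e (i, i)))
    fun _ => Set.finite_Icc _ _).subset ?_
  rintro z (h : q z = e) i
  have := hq z i
  rw [h] at this
  constructor <;> nlinarith

theorem finiteFibers_gramDegree : FiniteFibers gramDegree :=
  finiteFibers_of_diag fun z i => by
    rw [gramDegree_apply]; nlinarith [sq_nonneg (z i)]

theorem finiteFibers_two_gramDegree : FiniteFibers fun z => gramDegree z + gramDegree z :=
  finiteFibers_of_diag fun z i => by
    rw [Finsupp.add_apply, Nat.cast_add, gramDegree_apply]; nlinarith [sq_nonneg (z i)]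

/-- The weight of an integer in the theta series of characteristic `(a, b)`. -/
noncomputable def thetaWeight (m : Fin 2 × Fin 2) (k : ℤ) : ℚ :=
  if k % 4 = m.1.val then 1 else if k % 4 = m.1.val + 2 then (-1) ^ m.2.val else 0

/-- The indicator function of a class modulo `2`. -/
noncomputable def classWeight (c : Fin 2) (k : ℤ) : ℚ := if k % 2 = c.val then 1 else 0

/-- The theta series of degree `3` with characteristic `m`. -/
noncomputable def thetaSeries (m : Fin 3 → Fin 2 × Fin 2) : MvPowerSeries (Fin 3 × Fin 3) ℚ :=
  genSeries gramDegree fun z => ∏ j, thetaWeight (m j) (z j)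

/-- The second order theta series of degree `3` of the class `c`. -/
noncomputable def thetaSecond (c : Fin 3 → Fin 2) : MvPowerSeries (Fin 3 × Fin 3) ℚ :=
  genSeries (fun z => gramDegree z + gramDegree z) fun z => ∏ j, classWeight (c j) (z j)

/-- The two arguments add up to `2 * u` and both must be congruent to `m.1` modulo 2, so `v` has the
class of `u` shifted by `m.1`, and the combined sign depends only on the class of `u`. -/
theorem thetaWeight_add_mul_sub (m : Fin 2 × Fin 2) (u v : ℤ) :
    thetaWeight m (u + v) * thetaWeight m (u - v) =
      ∑ c, (charSign m c : ℚ) * (classWeight c u * classWeight (c + m.1) v) := by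
  obtain ⟨a, b⟩ := m
  have hu : u % 4 = 0 ∨ u % 4 = 1 ∨ u % 4 = 2 ∨ u % 4 = 3 := by omega
  have hv : v % 4 = 0 ∨ v % 4 = 1 ∨ v % 4 = 2 ∨ v % 4 = 3 := by omega
  have h2 : ∀ k : ℤ, k % 2 = k % 4 % 2 := by intro k; omega
  rw [Fin.sum_univ_two]
  simp only [thetaWeight, classWeight, charSign, h2 u, h2 v, Int.add_emod u v, Int.sub_emod u v]
  rcases hu with hu | hu | hu | hu <;> rcases hv with hv | hv | hv | hv <;>
    rw [hu, hv] <;> fin_cases a <;> fin_cases b <;> norm_num [show (1 + 1 : Fin 2) = 0 from rfl]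

theorem thetaWeight_ne_zero {m : Fin 2 × Fin 2} {k : ℤ} (h : thetaWeight m k ≠ 0) :
    k % 2 = m.1.val := by
  have := m.1.isLt
  unfold thetaWeight at h
  split_ifs at h with h1 h2
  · omega
  · omega
  · exact absurd rfl h

/-- Duplication formula: the substitution z = u + v, w = u − v turns a sum over pairs `(z, w)` of
equal parity into a sum over all `(u, v)`, and the parallelogram law doubles the degrees. -/
theorem thetaSeries_sq (m : Fin 3 → Fin 2 × Fin 2) :
    thetaSeries m ^ 2 = ∑ c : Fin 3 → Fin 2, ((∏ j, charSign (m j) (c j) : ℤ) :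
      MvPowerSeries (Fin 3 × Fin 3) ℚ) * (thetaSecond c * thetaSecond fun j => c j + (m j).1) := by
  have hsum : genSeries (fun p : (Fin 3 → ℤ) × (Fin 3 → ℤ) => (gramDegree p.1 + gramDegree p.1) +
      (gramDegree p.2 + gramDegree p.2)) (fun p => ∏ j,
      (thetaWeight (m j) (p.1 j + p.2 j) * thetaWeight (m j) (p.1 j - p.2 j))) =
      ∑ c : Fin 3 → Fin 2, ((∏ j, charSign (m j) (c j) : ℤ) :
      MvPowerSeries (Fin 3 × Fin 3) ℚ) * (thetaSecond c * thetaSecond fun j => c j + (m j).1) := by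
    have hf := finiteFibers_two_gramDegree.prod finiteFibers_two_gramDegree
    simp only [thetaSecond, genSeries_mul finiteFibers_two_gramDegree finiteFibers_two_gramDegree,
      ← genSeries_intCast_mul hf, ← genSeries_sum hf]
    congr 1
    funext p
    simp only [thetaWeight_add_mul_sub, Finset.prod_univ_sum, Fintype.piFinset_univ, Int.cast_prod,
      Finset.prod_mul_distrib]
  rw [← hsum, sq, thetaSeries, genSeries_mul finiteFibers_gramDegree finiteFibers_gramDegree]
  refine genSeries_congr (finiteFibers_gramDegree.prod finiteFibers_gramDegree)
    (finiteFibers_two_gramDegree.prod finiteFibers_two_gramDegree)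
    (fun p => (fun j => (p.1 j + p.2 j) / 2, fun j => (p.1 j - p.2 j) / 2))
    (fun p => (p.1 + p.2, p.1 - p.2)) ?_ ?_
  · rintro ⟨z, w⟩ h
    simp only [mul_ne_zero_iff, Finset.prod_ne_zero_iff, Finset.mem_univ, true_imp_iff] at h
    have hz j := thetaWeight_ne_zero (h.1 j)
    have hw j := thetaWeight_ne_zero (h.2 j)
    have hadd j : (z j + w j) / 2 + (z j - w j) / 2 = z j := by have := hz j; have := hw j; omega
    have hsub j : (z j + w j) / 2 - (z j - w j) / 2 = w j := by have := hz j; have := hw j; omega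
    refine ⟨?_, ?_, ?_⟩
    · ext p
      apply Nat.cast_injective (R := ℤ)
      simp only [Finsupp.add_apply, Nat.cast_add, gramDegree_apply]
      have key : ∀ s t s' t' a b a' b' : ℤ, s + t = a → s - t = b → s' + t' = a' → s' - t' = b' →
          (s + s') ^ 2 + (s + s') ^ 2 + ((t + t') ^ 2 + (t + t') ^ 2) =
            (a + a') ^ 2 + (b + b') ^ 2 := by
        rintro s t s' t' _ _ _ _ rfl rfl rfl rfl
        ring
      exact key _ _ _ _ _ _ _ _ (hadd p.1) (hsub p.1) (hadd p.2) (hsub p.2)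
    · simp only [hadd, hsub, Finset.prod_mul_distrib]
    · simp only [Prod.mk.injEq]
      exact ⟨funext hadd, funext hsub⟩
  · rintro ⟨u, v⟩ h
    refine ⟨by simpa only [Finset.prod_mul_distrib, Pi.add_apply, Pi.sub_apply] using h, ?_⟩
    simp only [Prod.mk.injEq]
    constructor <;> funext j <;> simp only [Pi.add_apply, Pi.sub_apply] <;> omega

theorem sum_fin_three {α M : Type*} [Fintype α] [AddCommMonoid M] (F : (Fin 3 → α) → M) :
    ∑ m, F m = ∑ a, ∑ b, ∑ c, F ![a, b, c] := by
  simp only [← Fintype.sum_prod_type']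
  refine Fintype.sum_equiv ⟨fun m => (m 0, m 1, m 2), fun p => ![p.1, p.2.1, p.2.2],
    fun m => by ext i; fin_cases i <;> rfl, fun p => rfl⟩ _ _ fun m => ?_
  congr 1
  ext i; fin_cases i <;> rfl

/-- The signs and shifts of the duplication formula factor over the three coordinates: the sum over
the first is `charPairing`, those over the other two form `charForm`. -/
theorem thetaSeries_sq_eq_charForm (l m n : Fin 2 × Fin 2) :
    thetaSeries ![l, m, n] ^ 2 =
      charForm (charPairing (fun a b c => thetaSecond ![a, b, c]) l) m n := by
  have hvec (a b c : Fin 2) : (fun j => (![a, b, c] : Fin 3 → Fin 2) j +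
      ((![l, m, n] : Fin 3 → Fin 2 × Fin 2) j).1) = ![a + l.1, b + m.1, c + n.1] := by
    ext j; fin_cases j <;> rfl
  rw [thetaSeries_sq, sum_fin_three]
  simp only [charForm, charPairing, hvec, Fin.prod_univ_three, Matrix.cons_val, Finset.mul_sum]
  rw [Finset.sum_comm]
  refine Finset.sum_congr rfl fun b _ => ?_
  rw [Finset.sum_comm]
  refine Finset.sum_congr rfl fun c _ => Finset.sum_congr rfl fun a _ => ?_
  push_cast
  ring

end ThetaSeries

/-! ### Riemann's relation from triality of D_4 -/

section RiemannRelation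

/-- The generating series of the triples of vectors `y₀, y₁, y₂` of `ℤ⁴`, by Gram matrix, with the
weight `A y₀ * B y₁ * C y₂`. -/
noncomputable def rowSeries (A B C : (Fin 4 → ℤ) → ℚ) : MvPowerSeries (Fin 3 × Fin 3) ℚ :=
  genSeries (fun z : Fin 4 → Fin 3 → ℤ => ∑ i, gramDegree (z i))
    fun z => A (fun i => z i 0) * B (fun i => z i 1) * C (fun i => z i 2)

theorem sum_gramDegree_apply {ι : Type*} [Fintype ι] (z : ι → Fin 3 → ℤ) (p : Fin 3 × Fin 3) :
    ((∑ i, gramDegree (z i)) p : ℤ) = ∑ i, (z i p.1 + z i p.2) ^ 2 := by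
  simp [Finsupp.finsetSum_apply, gramDegree_apply]

/-- A partially defined isometric involution `g` of `ℤ⁴` transports weights. -/
theorem rowSeries_congr (g : (Fin 4 → ℤ) → Fin 4 → ℤ) (S : Set (Fin 4 → ℤ))
    (hinv : ∀ y ∈ S, g (g y) = y)
    (hiso : ∀ y ∈ S, ∀ y' ∈ S, ∑ i, (g y i + g y' i) ^ 2 = ∑ i, (y i + y' i) ^ 2)
    {A B C A' B' C' : (Fin 4 → ℤ) → ℚ}
    (hA : ∀ y, A y ≠ 0 → y ∈ S ∧ A' (g y) = A y) (hA' : ∀ y, A' y ≠ 0 → y ∈ S ∧ A (g y) = A' y)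
    (hB : ∀ y, B y ≠ 0 → y ∈ S ∧ B' (g y) = B y) (hB' : ∀ y, B' y ≠ 0 → y ∈ S ∧ B (g y) = B' y)
    (hC : ∀ y, C y ≠ 0 → y ∈ S ∧ C' (g y) = C y) (hC' : ∀ y, C' y ≠ 0 → y ∈ S ∧ C (g y) = C' y) :
    rowSeries A B C = rowSeries A' B' C' := by
  have hrows {A B C : (Fin 4 → ℤ) → ℚ} {z : Fin 4 → Fin 3 → ℤ}
      (hA : A (fun i => z i 0) ≠ 0 → (fun i => z i 0) ∈ S)
      (hB : B (fun i => z i 1) ≠ 0 → (fun i => z i 1) ∈ S)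
      (hC : C (fun i => z i 2) ≠ 0 → (fun i => z i 2) ∈ S)
      (h : A (fun i => z i 0) * B (fun i => z i 1) * C (fun i => z i 2) ≠ 0) (j : Fin 3) :
      (fun i => z i j) ∈ S := by
    rw [mul_ne_zero_iff, mul_ne_zero_iff] at h
    fin_cases j
    · exact hA h.1.1
    · exact hB h.1.2
    · exact hC h.2
  have hinv' {z : Fin 4 → Fin 3 → ℤ} (hS : ∀ j, (fun i => z i j) ∈ S) :
      (fun i j => g (fun i' => g (fun i'' => z i'' j) i') i) = z := by
    funext i j
    exact congrFun (hinv _ (hS j)) i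
  refine genSeries_congr finiteFibers_gramDegree.pi finiteFibers_gramDegree.pi
    (fun z i j => g (fun i' => z i' j) i) (fun z i j => g (fun i' => z i' j) i) ?_ ?_
  · intro z h
    have hS := hrows (fun h => (hA _ h).1) (fun h => (hB _ h).1) (fun h => (hC _ h).1) h
    rw [mul_ne_zero_iff, mul_ne_zero_iff] at h
    refine ⟨?_, ?_, hinv' hS⟩
    · ext p
      apply Nat.cast_injective (R := ℤ)
      rw [sum_gramDegree_apply, sum_gramDegree_apply]
      exact hiso _ (hS p.1) _ (hS p.2)
    · rw [← (hA _ h.1.1).2, ← (hB _ h.1.2).2, ← (hC _ h.2).2]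
  · intro z h
    have hS := hrows (fun h => (hA' _ h).1) (fun h => (hB' _ h).1) (fun h => (hC' _ h).1) h
    refine ⟨?_, hinv' hS⟩
    have h' := h
    rw [mul_ne_zero_iff, mul_ne_zero_iff] at h'
    rw [← (hA' _ h'.1.1).2, ← (hB' _ h'.1.2).2, ← (hC' _ h'.2).2] at h
    exact h

theorem rowSeries_comp (g : (Fin 4 → ℤ) → Fin 4 → ℤ) (hinv : ∀ y, g (g y) = y)
    (hiso : ∀ y y', ∑ i, (g y i + g y' i) ^ 2 = ∑ i, (y i + y' i) ^ 2) (A B C : (Fin 4 → ℤ) → ℚ) :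
    rowSeries A B C = rowSeries (fun y => A (g y)) (fun y => B (g y)) fun y => C (g y) :=
  rowSeries_congr g Set.univ (fun y _ => hinv y) (fun y _ y' _ => hiso y y')
    (fun y _ => ⟨trivial, by rw [hinv]⟩) (fun y _ => ⟨trivial, rfl⟩)
    (fun y _ => ⟨trivial, by rw [hinv]⟩) (fun y _ => ⟨trivial, rfl⟩)
    (fun y _ => ⟨trivial, by rw [hinv]⟩) (fun y _ => ⟨trivial, rfl⟩)

theorem rowSeries_add_left (A A' B C : (Fin 4 → ℤ) → ℚ) :
    rowSeries (fun y => A y + A' y) B C = rowSeries A B C + rowSeries A' B C := by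
  unfold rowSeries
  rw [← genSeries_add finiteFibers_gramDegree.pi]
  congr 1; funext z; ring

theorem rowSeries_add_middle (A B B' C : (Fin 4 → ℤ) → ℚ) :
    rowSeries A (fun y => B y + B' y) C = rowSeries A B C + rowSeries A B' C := by
  unfold rowSeries
  rw [← genSeries_add finiteFibers_gramDegree.pi]
  congr 1; funext z; ring

theorem rowSeries_add_right (A B C C' : (Fin 4 → ℤ) → ℚ) :
    rowSeries A B (fun y => C y + C' y) = rowSeries A B C + rowSeries A B C' := by
  unfold rowSeries
  rw [← genSeries_add finiteFibers_gramDegree.pi]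
  congr 1; funext z; ring

/-- The sign given by the parity of half of an even integer. -/
def halfSign (k : ℤ) : ℚ := if k % 4 = 0 then 1 else -1

/-- The indicator function of the quadruples of even integers, with the sign of `(c + d) / 2`. -/
def evenWeight (a b c d : ℤ) : ℚ :=
  if a % 2 = 0 ∧ b % 2 = 0 ∧ c % 2 = 0 ∧ d % 2 = 0 then halfSign (c + d) else 0

/-- The restriction of `evenWeight` to the quadruples with sum divisible by `4`. -/
def rootWeight (a b c d : ℤ) : ℚ :=
  if (a + b + c + d) % 4 = 0 then evenWeight a b c d else 0

/-- The indicator function of the quadruples of even integers with sum not divisible by `4`. -/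
def vectorWeight (a b c d : ℤ) : ℚ :=
  if a % 2 = 0 ∧ b % 2 = 0 ∧ c % 2 = 0 ∧ d % 2 = 0 ∧ (a + b + c + d) % 4 = 2 then 1 else 0

/-- The indicator function of the quadruples of odd integers with sum divisible by `4`. -/
def spinorWeight (a b c d : ℤ) : ℚ :=
  if a % 2 = 1 ∧ b % 2 = 1 ∧ c % 2 = 1 ∧ d % 2 = 1 ∧ (a + b + c + d) % 4 = 0 then 1 else 0

theorem evenWeight_swap (a b c d : ℤ) : evenWeight b a d c = evenWeight a b c d := by
  unfold evenWeight halfSign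
  split_ifs <;> first | omega | rfl

theorem rootWeight_swap (a b c d : ℤ) : rootWeight b a d c = rootWeight a b c d := by
  unfold rootWeight
  rw [evenWeight_swap]
  split_ifs <;> first | omega | rfl

theorem rootWeight_neg (a b c d : ℤ) : rootWeight (-a) b c d = rootWeight a b c d := by
  unfold rootWeight evenWeight halfSign
  split_ifs <;> first | omega | rfl

/-- The signs of `(c + d) / 2` and `(a + b) / 2` agree exactly when the total is divisible by 4, and
cancel otherwise. -/
theorem evenWeight_add (a b c d : ℤ) :
    evenWeight a b c d + evenWeight c d a b = rootWeight a b c d + rootWeight a b c d := by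
  unfold rootWeight evenWeight halfSign
  split_ifs <;> first | omega | norm_num

theorem rootWeight_eq {a b c d : ℤ}
    (h : a % 2 = 0 ∧ b % 2 = 0 ∧ c % 2 = 0 ∧ d % 2 = 0 ∧ (a + b + c + d) % 4 = 0) :
    rootWeight a b c d = halfSign (c + d) := by
  rw [rootWeight, if_pos h.2.2.2.2, evenWeight, if_pos ⟨h.1, h.2.1, h.2.2.1, h.2.2.2.1⟩]

theorem rootWeight_ne_zero {a b c d : ℤ} (h : rootWeight a b c d ≠ 0) :
    a % 2 = 0 ∧ b % 2 = 0 ∧ c % 2 = 0 ∧ d % 2 = 0 ∧ (a + b + c + d) % 4 = 0 := by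
  unfold rootWeight evenWeight at h
  split_ifs at h with h1 h2
  · exact ⟨h2.1, h2.2.1, h2.2.2.1, h2.2.2.2, h1⟩
  · exact absurd rfl h
  · exact absurd rfl h

theorem vectorWeight_ne_zero {a b c d : ℤ} (h : vectorWeight a b c d ≠ 0) :
    a % 2 = 0 ∧ b % 2 = 0 ∧ c % 2 = 0 ∧ d % 2 = 0 ∧ (a + b + c + d) % 4 = 2 := by
  unfold vectorWeight at h
  exact of_not_not fun h' => h (if_neg h')

theorem spinorWeight_ne_zero {a b c d : ℤ} (h : spinorWeight a b c d ≠ 0) :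
    a % 2 = 1 ∧ b % 2 = 1 ∧ c % 2 = 1 ∧ d % 2 = 1 ∧ (a + b + c + d) % 4 = 0 := by
  unfold spinorWeight at h
  exact of_not_not fun h' => h (if_neg h')

theorem thetaWeight_zero_zero (k : ℤ) : thetaWeight (0, 0) k = if k % 2 = 0 then 1 else 0 := by
  simp only [thetaWeight, Fin.val_zero, Nat.cast_zero, zero_add, pow_zero]
  split_ifs <;> first | rfl | omega

theorem thetaWeight_one_zero (k : ℤ) : thetaWeight (1, 0) k = if k % 2 = 1 then 1 else 0 := by
  simp only [thetaWeight, Fin.val_zero, Fin.val_one, Nat.cast_one, pow_zero]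
  split_ifs <;> first | rfl | omega

theorem thetaWeight_zero_one (k : ℤ) :
    thetaWeight (0, 1) k = if k % 2 = 0 then halfSign k else 0 := by
  simp only [thetaWeight, Fin.val_zero, Fin.val_one, Nat.cast_zero, zero_add, pow_one, halfSign]
  split_ifs <;> first | rfl | omega

theorem halfSign_add {k l : ℤ} (hk : k % 2 = 0) (hl : l % 2 = 0) :
    halfSign (k + l) = halfSign k * halfSign l := by
  unfold halfSign
  split_ifs <;> first | omega | norm_num

theorem thetaWeight_mul_eq_evenWeight (a b c d : ℤ) :
    thetaWeight (0, 0) a * thetaWeight (0, 0) b * thetaWeight (0, 1) c * thetaWeight (0, 1) d =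
      evenWeight a b c d := by
  simp only [thetaWeight_zero_one, thetaWeight_zero_zero, evenWeight]
  by_cases h : a % 2 = 0 ∧ b % 2 = 0 ∧ c % 2 = 0 ∧ d % 2 = 0
  · rw [if_pos h, if_pos h.1, if_pos h.2.1, if_pos h.2.2.1, if_pos h.2.2.2,
      halfSign_add h.2.2.1 h.2.2.2]
    ring
  · rw [if_neg h]
    split_ifs <;> first | omega | simp

/-- On even vectors the product of the signs is 1 or −1 as the sum is 0 or 2 modulo 4, so the two
products differ by twice the vector class of D_4 (scaled by 2). -/
theorem thetaWeight_zero_zero_eq (a b c d : ℤ) :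
    thetaWeight (0, 0) a * thetaWeight (0, 0) b * thetaWeight (0, 0) c * thetaWeight (0, 0) d =
      thetaWeight (0, 1) a * thetaWeight (0, 1) b * thetaWeight (0, 1) c * thetaWeight (0, 1) d +
      (vectorWeight a b c d + vectorWeight a b c d) := by
  simp only [thetaWeight_zero_one, thetaWeight_zero_zero, vectorWeight]
  by_cases h : a % 2 = 0 ∧ b % 2 = 0 ∧ c % 2 = 0 ∧ d % 2 = 0
  · obtain ⟨ha, hb, hc, hd⟩ := h
    rw [if_pos ha, if_pos hb, if_pos hc, if_pos hd, if_pos ha, if_pos hb, if_pos hc, if_pos hd,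
      ← halfSign_add ha hb, ← halfSign_add (by omega) hc, ← halfSign_add (by omega) hd, halfSign]
    split_ifs <;> first | omega | norm_num
  · have h' : ¬(a % 2 = 0 ∧ b % 2 = 0 ∧ c % 2 = 0 ∧ d % 2 = 0 ∧ (a + b + c + d) % 4 = 2) :=
      fun h' => h ⟨h'.1, h'.2.1, h'.2.2.1, h'.2.2.2.1⟩
    rw [if_neg h']
    split_ifs <;> first | omega | simp

/-- The odd vectors split into the two spinor classes, which a sign change of one coordinate
exchanges. -/
theorem thetaWeight_one_zero_eq (a b c d : ℤ) :
    thetaWeight (1, 0) a * thetaWeight (1, 0) b * thetaWeight (1, 0) c * thetaWeight (1, 0) d =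
      spinorWeight a b c d + spinorWeight (-a) b c d := by
  simp only [thetaWeight_one_zero, spinorWeight]
  split_ifs <;> first | omega | norm_num

theorem eq_of_add_self_eq {x y : MvPowerSeries (Fin 3 × Fin 3) ℚ} (h : x + x = y + y) :
    x = y := by
  ext e
  have := congrArg (MvPowerSeries.coeff e) h
  simp only [map_add] at this
  linarith

/-- The product of four theta series with a common first characteristic, as a series of triples
in `ℤ⁴`. -/
theorem prod_thetaSeries (l : Fin 2 × Fin 2) :
    thetaSeries ![l, (0, 0), (0, 0)] * thetaSeries ![l, (0, 0), (0, 1)] *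
      thetaSeries ![l, (0, 1), (0, 0)] * thetaSeries ![l, (0, 1), (0, 1)] =
    rowSeries (fun y => thetaWeight l (y 0) * thetaWeight l (y 1) * thetaWeight l (y 2) *
      thetaWeight l (y 3)) (fun y => evenWeight (y 0) (y 1) (y 2) (y 3))
      fun y => evenWeight (y 0) (y 2) (y 1) (y 3) := by
  have := genSeries_pi finiteFibers_gramDegree (n := 4) fun i z => ∏ j, thetaWeight
    ((![![l, (0, 0), (0, 0)], ![l, (0, 0), (0, 1)], ![l, (0, 1), (0, 0)], ![l, (0, 1), (0, 1)]] :
      Fin 4 → Fin 3 → Fin 2 × Fin 2) i j) (z j)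
  rw [Fin.prod_univ_four] at this
  refine this.trans ?_
  unfold rowSeries
  congr 1
  funext z
  simp only [← thetaWeight_mul_eq_evenWeight, Fin.prod_univ_four, Fin.prod_univ_three,
    Matrix.cons_val]
  ring

theorem vecCons_eta (y : Fin 4 → ℤ) : ![y 0, y 1, y 2, y 3] = y := by
  ext i; fin_cases i <;> rfl

/-- Averaging over coordinate permutations that preserve `A`: exchanging the two halves symmetrizes
the second weight and fixes the third, while exchanging neighbours symmetrizes the third and fixes
the second. Both weights become supported on the scaled root lattice. -/
theorem rowSeries_evenWeight {A : (Fin 4 → ℤ) → ℚ}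
    (hA : ∀ y, A ![y 2, y 3, y 0, y 1] = A y) (hA' : ∀ y, A ![y 1, y 0, y 3, y 2] = A y) :
    rowSeries A (fun y => evenWeight (y 0) (y 1) (y 2) (y 3))
        (fun y => evenWeight (y 0) (y 2) (y 1) (y 3)) =
      rowSeries A (fun y => rootWeight (y 0) (y 1) (y 2) (y 3))
        fun y => rootWeight (y 0) (y 2) (y 1) (y 3) := by
  trans rowSeries A (fun y => rootWeight (y 0) (y 1) (y 2) (y 3))
    fun y => evenWeight (y 0) (y 2) (y 1) (y 3)
  · have h := rowSeries_comp (fun y => ![y 2, y 3, y 0, y 1]) vecCons_eta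
      (fun y y' => by simp only [Fin.sum_univ_four, Matrix.cons_val]; ring) A
      (fun y => evenWeight (y 0) (y 1) (y 2) (y 3)) (fun y => evenWeight (y 0) (y 2) (y 1) (y 3))
    simp only [Matrix.cons_val, hA, evenWeight_swap (_ : ℤ) _ (_ : ℤ) _] at h
    apply eq_of_add_self_eq
    conv_lhs => enter [2]; rw [h]
    simp only [← rowSeries_add_middle, ← evenWeight_add]
  · have h := rowSeries_comp (fun y => ![y 1, y 0, y 3, y 2]) vecCons_eta
      (fun y y' => by simp only [Fin.sum_univ_four, Matrix.cons_val]; ring) A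
      (fun y => rootWeight (y 0) (y 1) (y 2) (y 3)) (fun y => evenWeight (y 0) (y 2) (y 1) (y 3))
    simp only [Matrix.cons_val, hA', rootWeight_swap] at h
    apply eq_of_add_self_eq
    conv_lhs => enter [2]; rw [h]
    simp only [← rowSeries_add_right, ← evenWeight_add]

/-- Half of the Hadamard matrix of order `4`. -/
def hadamardHalf (y : Fin 4 → ℤ) : Fin 4 → ℤ :=
  ![(y 0 + y 1 + y 2 + y 3) / 2, (y 0 + y 1 - y 2 - y 3) / 2, (y 0 - y 1 + y 2 - y 3) / 2,
    (y 0 - y 1 - y 2 + y 3) / 2]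

/-- The sign survives because u + v = a − b, which is congruent to c + d modulo 4 for even entries
with sum divisible by 4. -/
theorem rootWeight_hadamard {a b c d s t u v : ℤ} (h : rootWeight a b c d ≠ 0)
    (hs : 2 * s = a + b + c + d) (ht : 2 * t = a + b - c - d) (hu : 2 * u = a - b + c - d)
    (hv : 2 * v = a - b - c + d) : rootWeight s t u v = rootWeight a b c d := by
  obtain rfl : d = 2 * s - a - b - c := by linarith
  obtain rfl : t = a + b - s := by linarith
  obtain rfl : u = a + c - s := by linarith
  obtain rfl : v = s - b - c := by linarith
  clear hs ht hu hv
  obtain ⟨ha, hb, hc, hd, h4⟩ := rootWeight_ne_zero h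
  clear h
  have hiff : (a + c - s + (s - b - c)) % 4 = 0 ↔ (c + (2 * s - a - b - c)) % 4 = 0 := by omega
  rw [rootWeight_eq ⟨ha, hb, hc, hd, h4⟩, rootWeight_eq (by omega)]
  simp only [halfSign, hiff]

theorem spinorWeight_hadamard {a b c d s t u v : ℤ} (h : vectorWeight a b c d ≠ 0)
    (hs : 2 * s = a + b + c + d) (ht : 2 * t = a + b - c - d) (hu : 2 * u = a - b + c - d)
    (hv : 2 * v = a - b - c + d) : spinorWeight s t u v = vectorWeight a b c d := by
  obtain rfl : d = 2 * s - a - b - c := by linarith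
  obtain rfl : t = a + b - s := by linarith
  obtain rfl : u = a + c - s := by linarith
  obtain rfl : v = s - b - c := by linarith
  clear hs ht hu hv
  obtain ⟨ha, hb, hc, hd, h4⟩ := vectorWeight_ne_zero h
  unfold spinorWeight vectorWeight
  rw [if_pos (by omega), if_pos ⟨ha, hb, hc, hd, h4⟩]

theorem vectorWeight_hadamard {a b c d s t u v : ℤ} (h : spinorWeight a b c d ≠ 0)
    (hs : 2 * s = a + b + c + d) (ht : 2 * t = a + b - c - d) (hu : 2 * u = a - b + c - d)
    (hv : 2 * v = a - b - c + d) : vectorWeight s t u v = spinorWeight a b c d := by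
  obtain rfl : d = 2 * s - a - b - c := by linarith
  obtain rfl : t = a + b - s := by linarith
  obtain rfl : u = a + c - s := by linarith
  obtain rfl : v = s - b - c := by linarith
  clear hs ht hu hv
  obtain ⟨ha, hb, hc, hd, h4⟩ := spinorWeight_ne_zero h
  unfold spinorWeight vectorWeight
  rw [if_pos (by omega), if_pos ⟨ha, hb, hc, hd, h4⟩]

/-- Triality: the Hadamard involution carries the vector class to a spinor class and fixes both root
weights. The second root weight is covered as well, since the matrix commutes with exchanging the
two middle coordinates. -/
theorem rowSeries_vectorWeight :
    rowSeries (fun y => vectorWeight (y 0) (y 1) (y 2) (y 3))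
        (fun y => rootWeight (y 0) (y 1) (y 2) (y 3))
        (fun y => rootWeight (y 0) (y 2) (y 1) (y 3)) =
      rowSeries (fun y => spinorWeight (y 0) (y 1) (y 2) (y 3))
        (fun y => rootWeight (y 0) (y 1) (y 2) (y 3))
        fun y => rootWeight (y 0) (y 2) (y 1) (y 3) := by
  have hroot (y : Fin 4 → ℤ) (h : rootWeight (y 0) (y 1) (y 2) (y 3) ≠ 0) :
      y ∈ {y : Fin 4 → ℤ | (y 0 + y 1 + y 2 + y 3) % 2 = 0} ∧
      rootWeight (hadamardHalf y 0) (hadamardHalf y 1) (hadamardHalf y 2) (hadamardHalf y 3) =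
        rootWeight (y 0) (y 1) (y 2) (y 3) := by
    obtain ⟨h0, h1, h2, h3, hs⟩ := rootWeight_ne_zero h
    refine ⟨show _ % 2 = 0 by omega, ?_⟩
    simp only [hadamardHalf, Matrix.cons_val]
    exact rootWeight_hadamard h (by omega) (by omega) (by omega) (by omega)
  have hroot' (y : Fin 4 → ℤ) (h : rootWeight (y 0) (y 2) (y 1) (y 3) ≠ 0) :
      y ∈ {y : Fin 4 → ℤ | (y 0 + y 1 + y 2 + y 3) % 2 = 0} ∧
      rootWeight (hadamardHalf y 0) (hadamardHalf y 2) (hadamardHalf y 1) (hadamardHalf y 3) =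
        rootWeight (y 0) (y 2) (y 1) (y 3) := by
    obtain ⟨h0, h1, h2, h3, hs⟩ := rootWeight_ne_zero h
    refine ⟨show _ % 2 = 0 by omega, ?_⟩
    simp only [hadamardHalf, Matrix.cons_val]
    exact rootWeight_hadamard h (by omega) (by omega) (by omega) (by omega)
  -- When the coordinate sum is even, all four divisions by 2 are exact, and there the map is an
  -- isometric involution.
  refine rowSeries_congr hadamardHalf {y | (y 0 + y 1 + y 2 + y 3) % 2 = 0} ?_ ?_ ?_ ?_ hroot hroot
    hroot' hroot'
  · intro y (hy : _ % 2 = 0)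
    ext i
    fin_cases i <;> simp [hadamardHalf] <;> omega
  · intro y (hy : _ % 2 = 0) y' (hy' : _ % 2 = 0)
    have key : ∀ a b c d s t u v : ℤ, 2 * s = a + b + c + d → 2 * t = a + b - c - d →
        2 * u = a - b + c - d → 2 * v = a - b - c + d →
        s ^ 2 + t ^ 2 + u ^ 2 + v ^ 2 = a ^ 2 + b ^ 2 + c ^ 2 + d ^ 2 := by
      intro a b c d s t u v h1 h2 h3 h4
      obtain rfl : d = 2 * s - a - b - c := by linarith
      obtain rfl : t = a + b - s := by linarith
      obtain rfl : u = a + c - s := by linarith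
      obtain rfl : v = s - b - c := by linarith
      ring
    simp only [Fin.sum_univ_four, hadamardHalf, Matrix.cons_val]
    apply key <;> omega
  · intro y h
    obtain ⟨h0, h1, h2, h3, hs⟩ := vectorWeight_ne_zero h
    refine ⟨show _ % 2 = 0 by omega, ?_⟩
    simp only [hadamardHalf, Matrix.cons_val]
    exact spinorWeight_hadamard h (by omega) (by omega) (by omega) (by omega)
  · intro y h
    obtain ⟨h0, h1, h2, h3, hs⟩ := spinorWeight_ne_zero h
    refine ⟨show _ % 2 = 0 by omega, ?_⟩
    simp only [hadamardHalf, Matrix.cons_val]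
    exact vectorWeight_hadamard h (by omega) (by omega) (by omega) (by omega)

/-- Riemann's theta relation. -/
theorem riemann_relation :
    thetaSeries ![(0, 0), (0, 0), (0, 0)] * thetaSeries ![(0, 0), (0, 0), (0, 1)] *
      thetaSeries ![(0, 0), (0, 1), (0, 0)] * thetaSeries ![(0, 0), (0, 1), (0, 1)] =
    thetaSeries ![(0, 1), (0, 0), (0, 0)] * thetaSeries ![(0, 1), (0, 0), (0, 1)] *
      thetaSeries ![(0, 1), (0, 1), (0, 0)] * thetaSeries ![(0, 1), (0, 1), (0, 1)] +
    thetaSeries ![(1, 0), (0, 0), (0, 0)] * thetaSeries ![(1, 0), (0, 0), (0, 1)] *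
      thetaSeries ![(1, 0), (0, 1), (0, 0)] * thetaSeries ![(1, 0), (0, 1), (0, 1)] := by
  have hA (l : Fin 2 × Fin 2) : rowSeries (fun y => thetaWeight l (y 0) * thetaWeight l (y 1) *
      thetaWeight l (y 2) * thetaWeight l (y 3)) (fun y => evenWeight (y 0) (y 1) (y 2) (y 3))
      (fun y => evenWeight (y 0) (y 2) (y 1) (y 3)) = _ := rowSeries_evenWeight
    (fun y => by simp only [Matrix.cons_val]; ring) fun y => by simp only [Matrix.cons_val]; ring
  -- A sign change of the first coordinate identifies the contributions of the two spinor classes.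
  have hflip := rowSeries_comp (fun y => ![-y 0, y 1, y 2, y 3])
    (fun y => by simp only [Matrix.cons_val, neg_neg]; exact vecCons_eta y)
    (fun y y' => by simp only [Fin.sum_univ_four, Matrix.cons_val]; ring)
    (fun y => spinorWeight (y 0) (y 1) (y 2) (y 3))
    (fun y => rootWeight (y 0) (y 1) (y 2) (y 3)) fun y => rootWeight (y 0) (y 2) (y 1) (y 3)
  simp only [Matrix.cons_val, rootWeight_neg] at hflip
  rw [prod_thetaSeries, prod_thetaSeries, prod_thetaSeries, hA, hA, hA]
  simp only [thetaWeight_zero_zero_eq, thetaWeight_one_zero_eq, rowSeries_add_left]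
  rw [← hflip, rowSeries_vectorWeight]

end RiemannRelation

/-! ### Theta series of D_n^+ and vanishing of the Schottky form -/

section SchottkyRelation

/-- The integer vectors `y` such that `y / 2` belongs to `D_n^+`. -/
def IsTwiceDPlus {n : ℕ} (y : Fin n → ℤ) : Prop :=
  ((∀ i, y i % 2 = 0) ∨ ∀ i, y i % 2 = 1) ∧ (∑ i, y i) % 4 = 0

theorem prod_halfSign {ι : Type*} (s : Finset ι) (k : ι → ℤ) (hk : ∀ i ∈ s, k i % 2 = 0) :
    ∏ i ∈ s, halfSign (k i) = halfSign (∑ i ∈ s, k i) := by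
  classical
  induction s using Finset.induction_on with
  | empty => simp [halfSign]
  | insert a s ha ih =>
    have hs : (∑ i ∈ s, k i) % 2 = 0 := Int.emod_eq_zero_of_dvd (Finset.dvd_sum fun i hi =>
      Int.dvd_of_emod_eq_zero (hk i (Finset.mem_insert_of_mem hi)))
    rw [Finset.prod_insert ha, Finset.sum_insert ha, ih fun i hi =>
      hk i (Finset.mem_insert_of_mem hi),
      halfSign_add (hk a (Finset.mem_insert_self a s)) hs]

theorem thetaWeight_one_one (k : ℤ) :
    thetaWeight (1, 1) k = if k % 2 = 1 then halfSign (k - 1) else 0 := by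
  simp only [thetaWeight, Fin.val_one, Nat.cast_one, pow_one, halfSign]
  split_ifs <;> first | rfl | omega

theorem prod_thetaWeight_eq_zero {n : ℕ} {y : Fin n → ℤ} {m : Fin 2 × Fin 2} {i : Fin n}
    (hi : y i % 2 ≠ m.1.val) : ∏ i, thetaWeight m (y i) = 0 :=
  Finset.prod_eq_zero (Finset.mem_univ i) (of_not_not fun h => hi (thetaWeight_ne_zero h))

-- For each parity class the two characteristics give 1 plus or minus 1, which selects the sums
-- divisible by 4. On odd vectors the sign is that of the sum of the `y i - 1`, which agrees with
-- the sum of the `y i` modulo 4 because 4 divides `n`; `0 < n` keeps the two parity classes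
-- disjoint.
open Classical in
theorem sum_prod_thetaWeight {n : ℕ} (hn : 4 ∣ n) (hn0 : 0 < n) (y : Fin n → ℤ) :
    ∑ m, ∏ i, thetaWeight m (y i) = 2 * if IsTwiceDPlus y then 1 else 0 := by
  rw [Fintype.sum_prod_type, Fin.sum_univ_two, Fin.sum_univ_two, Fin.sum_univ_two]
  by_cases h0 : ∀ i, y i % 2 = 0
  · have hs : (∑ i, y i) % 2 = 0 := Int.emod_eq_zero_of_dvd (Finset.dvd_sum fun i _ =>
      Int.dvd_of_emod_eq_zero (h0 i))
    have hodd (b : Fin 2) : ∏ i, thetaWeight (1, b) (y i) = 0 :=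
      prod_thetaWeight_eq_zero (i := ⟨0, hn0⟩) (by rw [h0]; simp)
    simp only [hodd, thetaWeight_zero_zero, thetaWeight_zero_one, h0, if_true,
      Finset.prod_const_one]
    rw [prod_halfSign _ _ fun i _ => h0 i, halfSign]
    have hiff : IsTwiceDPlus y ↔ (∑ i, y i) % 4 = 0 := and_iff_right (Or.inl h0)
    simp only [hiff]
    split_ifs <;> norm_num
  by_cases h1 : ∀ i, y i % 2 = 1
  · have hd (i : Fin n) : (y i - 1) % 2 = 0 := by have := h1 i; omega
    have heven (b : Fin 2) : ∏ i, thetaWeight (0, b) (y i) = 0 :=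
      prod_thetaWeight_eq_zero (i := ⟨0, hn0⟩) (by rw [h1]; simp)
    simp only [heven, thetaWeight_one_zero, thetaWeight_one_one, h1, if_true,
      Finset.prod_const_one]
    rw [prod_halfSign _ _ fun i _ => hd i, halfSign, Finset.sum_sub_distrib]
    have hiff : IsTwiceDPlus y ↔ (∑ i, y i - ∑ _i : Fin n, (1 : ℤ)) % 4 = 0 := by
      refine (and_iff_right (Or.inr h1)).trans ?_
      simp only [Finset.sum_const, Finset.card_univ, Fintype.card_fin, nsmul_eq_mul, mul_one]
      omega
    simp only [hiff]
    split_ifs <;> norm_num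
  · have h : ¬IsTwiceDPlus y := fun h => h.1.elim h0 h1
    rw [if_neg h]
    push Not at h0 h1
    obtain ⟨i, hi⟩ := h0
    obtain ⟨j, hj⟩ := h1
    have heven (b : Fin 2) : ∏ i, thetaWeight (0, b) (y i) = 0 :=
      prod_thetaWeight_eq_zero (i := i) (by simpa using hi)
    have hodd (b : Fin 2) : ∏ i, thetaWeight (1, b) (y i) = 0 :=
      prod_thetaWeight_eq_zero (i := j) (by simpa using hj)
    simp only [heven, hodd]
    norm_num

open Classical in
/-- The generating series of the triples of vectors of `D_n^+`, by Gram matrix. -/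
noncomputable def dPlusSeries (n : ℕ) : MvPowerSeries (Fin 3 × Fin 3) ℚ :=
  genSeries (fun z : Fin n → Fin 3 → ℤ => ∑ i, gramDegree (z i))
    fun z => if ∀ j, IsTwiceDPlus (fun i => z i j) then 1 else 0

/-- The sum over characteristics factors over the three vectors of the triple, each giving a factor
2 and the condition of membership. -/
theorem sum_thetaSeries_pow {n : ℕ} (hn : 4 ∣ n) (hn0 : 0 < n) :
    ∑ m, thetaSeries m ^ n = 8 * dPlusSeries n := by
  classical
  have hpow (m : Fin 3 → Fin 2 × Fin 2) : thetaSeries m ^ n =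
      genSeries (fun z : Fin n → Fin 3 → ℤ => ∑ i, gramDegree (z i))
        fun z => ∏ j, ∏ i, thetaWeight (m j) (z i j) := by
    have h := genSeries_pi finiteFibers_gramDegree (n := n)
      fun _ z => ∏ j, thetaWeight (m j) (z j)
    rw [Finset.prod_const, Finset.card_univ, Fintype.card_fin] at h
    refine h.trans ?_
    congr 1
    funext z
    exact Finset.prod_comm
  have h8 := genSeries_intCast_mul (X := Fin n → Fin 3 → ℤ) finiteFibers_gramDegree.pi 8
    fun z => if ∀ j, IsTwiceDPlus (fun i => z i j) then 1 else 0
  simp only [hpow, ← genSeries_sum finiteFibers_gramDegree.pi]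
  rw [dPlusSeries]
  push_cast at h8
  rw [← h8]
  congr 1
  funext z
  have := Finset.prod_univ_sum (fun _ : Fin 3 => (Finset.univ : Finset (Fin 2 × Fin 2)))
    fun j m => ∏ i, thetaWeight m (z i j)
  rw [Fintype.piFinset_univ] at this
  rw [← this]
  simp only [sum_prod_thetaWeight hn hn0]
  rw [Finset.prod_mul_distrib, Finset.prod_const, Fintype.prod_boole]
  norm_num

theorem dPlusSeries_sixteen : dPlusSeries 16 = dPlusSeries 8 ^ 2 := by
  have key := schottky_identity (fun a b c => thetaSecond ![a, b, c]) _ fun l => rfl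
  simp only [← thetaSeries_sq_eq_charForm, ← pow_mul] at key
  norm_num only at key
  rw [← sum_fin_three fun m => thetaSeries m ^ 16, ← sum_fin_three fun m => thetaSeries m ^ 8,
    sum_thetaSeries_pow (by decide) (by decide), sum_thetaSeries_pow (by decide) (by decide)] at key
  have hR := riemann_relation
  simp only [← mul_pow] at key
  rw [hR] at key
  generalize thetaSeries ![(0, 1), (0, 0), (0, 0)] * thetaSeries ![(0, 1), (0, 0), (0, 1)] *
      thetaSeries ![(0, 1), (0, 1), (0, 0)] * thetaSeries ![(0, 1), (0, 1), (0, 1)] = r at key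
  generalize thetaSeries ![(1, 0), (0, 0), (0, 0)] * thetaSeries ![(1, 0), (0, 0), (0, 1)] *
      thetaSeries ![(1, 0), (0, 1), (0, 0)] * thetaSeries ![(1, 0), (0, 1), (0, 1)] = s at key
  -- The factor is 8 * 8 on both terms. With `r + s` for the first product, Heron's expression in `r
  -- + s`, `r`, `s` is identically zero.
  have h64 : 64 * (dPlusSeries 16 - dPlusSeries 8 ^ 2) = 0 := by
    refine Eq.trans (by ring) (key.trans (by ring))
  have h0 := (mul_eq_zero.1 h64).resolve_left (by
    intro h
    have := congrArg (MvPowerSeries.constantCoeff (σ := Fin 3 × Fin 3) (R := ℚ)) h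
    rw [map_ofNat, map_zero] at this
    norm_num at this)
  exact sub_eq_zero.1 h0

end SchottkyRelation

/-! ### Embeddings as triples with given Gram matrix -/

section GramTriples

variable {V W : Type*} [NormedAddCommGroup V] [InnerProductSpace ℝ V] [NormedAddCommGroup W]
  [InnerProductSpace ℝ W]

/-- The triples of vectors of `Λ` with Gram matrix `T`. -/
def GramTriple (Λ : Submodule ℤ V) (T : Fin 3 → Fin 3 → ℝ) : Type _ :=
  {v : Fin 3 → V // (∀ j, v j ∈ Λ) ∧ ∀ j k, inner ℝ (v j) (v k) = T j k}

/-- A basis padded with zeros: a generating family of fixed length treats all ranks at most `n` at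
once. -/
theorem exists_span_range_eq_top {L : Type*} [AddCommGroup L] [Module.Free ℤ L] [Module.Finite ℤ L]
    {n : ℕ} (h : Module.finrank ℤ L ≤ n) :
    ∃ b : Fin n → L, Submodule.span ℤ (Set.range b) = ⊤ := by
  let e := Module.finBasis ℤ L
  refine ⟨fun j => if hj : j.val < Module.finrank ℤ L then e ⟨j, hj⟩ else 0, ?_⟩
  rw [eq_top_iff, ← e.span_eq, Submodule.span_le]
  rintro _ ⟨i, rfl⟩
  refine Submodule.subset_span ⟨⟨i, i.2.trans_le h⟩, ?_⟩
  simp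

theorem inner_linearCombination {L : Type*} [AddCommGroup L] (B : L →ₗ[ℤ] L →ₗ[ℤ] ℝ)
    {Λ : Submodule ℤ V} {n : ℕ} {b : Fin n → L} {v : Fin n → Λ}
    (hv : ∀ j k, inner ℝ (v j : V) (v k : V) = B (b j) (b k)) (c d : Fin n → ℤ) :
    inner ℝ (Fintype.linearCombination ℤ v c : V) (Fintype.linearCombination ℤ v d : V) =
      B (Fintype.linearCombination ℤ b c) (Fintype.linearCombination ℤ b d) := by
  have hz (n : ℤ) (x : V) : n • x = (n : ℝ) • x := (Int.cast_smul_eq_zsmul ℝ n x).symm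
  simp only [Fintype.linearCombination_apply, Submodule.coe_sum, Submodule.coe_smul, map_sum,
    LinearMap.sum_apply, map_smul, LinearMap.smul_apply, sum_inner, inner_sum, hz,
    real_inner_smul_left, real_inner_smul_right, hv, zsmul_eq_mul,
    Finset.mul_sum]

theorem latticeEmbedding_equiv_gramTriple {L : Type*} [AddCommGroup L]
    (B : L →ₗ[ℤ] L →ₗ[ℤ] ℝ) (hpos : ∀ x, x ≠ 0 → 0 < B x x) {b : Fin 3 → L}
    (hb : Submodule.span ℤ (Set.range b) = ⊤) (Λ : Submodule ℤ V) :
    Nonempty (LatticeEmbedding B Λ ≃ GramTriple Λ fun j k => B (b j) (b k)) := by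
  refine ⟨Equiv.ofBijective (fun f => ⟨fun j => f.1 (b j), fun j => (f.1 (b j)).2,
    fun j k => f.2.2 _ _⟩) ⟨?_, ?_⟩⟩
  · intro f g h
    apply Subtype.ext
    refine LinearMap.ext_on hb ?_
    rintro _ ⟨j, rfl⟩
    exact Subtype.ext (congrFun (congrArg Subtype.val h) j)
  · rintro ⟨v, hv, hT⟩
    let w : Fin 3 → Λ := fun j => ⟨v j, hv j⟩
    have hsurj : Function.Surjective (Fintype.linearCombination ℤ b) := by
      rw [← LinearMap.range_eq_top, Fintype.range_linearCombination, hb]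
    have hinner := inner_linearCombination B (v := w) hT
    -- The generators need not be independent, but a relation among them yields a combination of the
    -- `w j` of norm zero, so the assignment of `w j` to `b j` is well defined.
    have hker : LinearMap.ker (Fintype.linearCombination ℤ b) ≤
        LinearMap.ker (Fintype.linearCombination ℤ w) := by
      intro c hc
      have := hinner c c
      rw [LinearMap.mem_ker.1 hc, map_zero, inner_self_eq_zero] at this
      exact Subtype.ext this
    let f : L →ₗ[ℤ] Λ := ((LinearMap.ker (Fintype.linearCombination ℤ b)).liftQ
      (Fintype.linearCombination ℤ w) hker).comp
      ((Fintype.linearCombination ℤ b).quotKerEquivOfSurjective hsurj).symm.toLinearMap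
    have hf (c : Fin 3 → ℤ) : f (Fintype.linearCombination ℤ b c) =
        Fintype.linearCombination ℤ w c := by
      have : ((Fintype.linearCombination ℤ b).quotKerEquivOfSurjective hsurj).symm
          (Fintype.linearCombination ℤ b c) = Submodule.Quotient.mk c := by
        rw [LinearEquiv.symm_apply_eq]; rfl
      simp only [f, LinearMap.comp_apply, LinearEquiv.coe_coe, this, Submodule.liftQ_apply]
    have hiso (x y : L) : inner ℝ (f x : V) (f y : V) = B x y := by
      obtain ⟨c, rfl⟩ := hsurj x
      obtain ⟨d, rfl⟩ := hsurj y
      rw [hf, hf, hinner]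
    refine ⟨⟨f, ?_, hiso⟩, Subtype.ext (funext fun j => ?_)⟩
    · rw [injective_iff_map_eq_zero]
      intro x hx
      by_contra h
      have := hiso x x
      rw [hx, Submodule.coe_zero, inner_zero_left] at this
      exact (hpos x h).ne this
    · have := hf (Pi.single j 1)
      simp only [Fintype.linearCombination_apply_single, one_smul] at this
      change ((f (b j) : Λ) : V) = v j
      rw [this]

/-- A parametrization of the triples of vectors of a lattice `Λ` by the elements of a graded set
that satisfy `p`, such that the degree determines the Gram matrix. -/
structure GramParametrization (Λ : Submodule ℤ V) {X : Type*} (q : X → Fin 3 × Fin 3 →₀ ℕ)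
    (p : X → Prop) (P : X → Fin 3 → V) : Prop where
  injective : Function.Injective P
  mem_iff : ∀ v : Fin 3 → V, (∀ j, v j ∈ Λ) ↔ ∃ x, p x ∧ P x = v
  degree : ∀ x j k, (q x (j, k) : ℝ) = 4 * ‖P x j + P x k‖ ^ 2

/-- Polarization: the diagonal case determines the norms, after which the remaining cases determine
the inner products. -/
theorem inner_eq_iff_norm_add_sq (v : Fin 3 → V) (T : Fin 3 → Fin 3 → ℝ) :
    (∀ j k, inner ℝ (v j) (v k) = T j k) ↔
      ∀ j k, ‖v j + v k‖ ^ 2 = T j j + T k k + 2 * T j k := by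
  simp only [norm_add_sq_real]
  simp only [← real_inner_self_eq_norm_sq]
  constructor
  · intro h j k
    rw [h, h, h]; ring
  · intro h j k
    have hj := h j j
    have hk := h k k
    have := h j k
    linarith

theorem GramParametrization.nonempty_equiv {Λ : Submodule ℤ V} {X : Type*}
    {q : X → Fin 3 × Fin 3 →₀ ℕ} {p : X → Prop} {P : X → Fin 3 → V}
    (h : GramParametrization Λ q p P) {T : Fin 3 → Fin 3 → ℝ} {e : Fin 3 × Fin 3 →₀ ℕ}
    (he : ∀ j k, (e (j, k) : ℝ) = 4 * (T j j + T k k + 2 * T j k)) :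
    Nonempty ({x // p x ∧ q x = e} ≃ GramTriple Λ T) := by
  have hiff (x : X) : q x = e ↔ ∀ j k, inner ℝ (P x j) (P x k) = T j k := by
    rw [inner_eq_iff_norm_add_sq]
    constructor
    · rintro rfl j k
      have := he j k
      rw [h.degree] at this
      linarith
    · intro hx
      ext ⟨j, k⟩
      have : (q x (j, k) : ℝ) = e (j, k) := by rw [h.degree, he, hx]
      exact_mod_cast this
  refine ⟨Equiv.ofBijective (fun x => ⟨P x.1, (h.mem_iff _).2 ⟨x.1, x.2.1, rfl⟩,
    (hiff _).1 x.2.2⟩) ⟨?_, ?_⟩⟩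
  · intro x y hxy
    exact Subtype.ext (h.injective (congrArg Subtype.val hxy))
  · rintro ⟨v, hv, hT⟩
    obtain ⟨x, hx, rfl⟩ := (h.mem_iff v).1 hv
    exact ⟨⟨x, hx, (hiff x).2 hT⟩, rfl⟩

theorem GramParametrization.exists_degree {Λ : Submodule ℤ V} {X : Type*}
    {q : X → Fin 3 × Fin 3 →₀ ℕ} {p : X → Prop} {P : X → Fin 3 → V}
    (h : GramParametrization Λ q p P) {T : Fin 3 → Fin 3 → ℝ} (v : GramTriple Λ T) :
    ∃ e : Fin 3 × Fin 3 →₀ ℕ, ∀ j k, (e (j, k) : ℝ) = 4 * (T j j + T k k + 2 * T j k) := by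
  obtain ⟨v, hv, hT⟩ := v
  obtain ⟨x, -, rfl⟩ := (h.mem_iff v).1 hv
  exact ⟨q x, fun j k => by rw [h.degree, (inner_eq_iff_norm_add_sq _ _).1 hT]⟩

theorem GramParametrization.card_eq {Λ : Submodule ℤ V} {M : Submodule ℤ W} {X Y : Type*}
    {q : X → Fin 3 × Fin 3 →₀ ℕ} {p : X → Prop} [DecidablePred p] {P : X → Fin 3 → V}
    {r : Y → Fin 3 × Fin 3 →₀ ℕ} {s : Y → Prop} [DecidablePred s] {Q : Y → Fin 3 → W}
    (hP : GramParametrization Λ q p P) (hQ : GramParametrization M r s Q) (hq : FiniteFibers q)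
    (hr : FiniteFibers r) (heq : genSeries q (fun x => if p x then 1 else 0) =
      genSeries r fun y => if s y then 1 else 0) (T : Fin 3 → Fin 3 → ℝ) :
    Finite (GramTriple Λ T) ∧ Finite (GramTriple M T) ∧
      Nat.card (GramTriple Λ T) = Nat.card (GramTriple M T) := by
  by_cases hT : ∃ e : Fin 3 × Fin 3 →₀ ℕ, ∀ j k, (e (j, k) : ℝ) = 4 * (T j j + T k k + 2 * T j k)
  · obtain ⟨e, he⟩ := hT
    obtain ⟨f⟩ := hP.nonempty_equiv he
    obtain ⟨g⟩ := hQ.nonempty_equiv he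
    have hX : Finite {x // p x ∧ q x = e} := ((hq e).subset fun x hx => hx.2).to_subtype
    have hY : Finite {y // s y ∧ r y = e} := ((hr e).subset fun x hx => hx.2).to_subtype
    refine ⟨Finite.of_equiv _ f, Finite.of_equiv _ g, ?_⟩
    have := congrArg (MvPowerSeries.coeff e) heq
    rw [coeff_genSeries_indicator hq, coeff_genSeries_indicator hr] at this
    rw [← Nat.card_congr f, ← Nat.card_congr g]
    exact_mod_cast this
  -- A matrix corresponding to no exponent is the Gram matrix of no triple in either lattice.
  · have : IsEmpty (GramTriple Λ T) := ⟨fun v => hT (hP.exists_degree v)⟩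
    have : IsEmpty (GramTriple M T) := ⟨fun v => hT (hQ.exists_degree v)⟩
    exact ⟨inferInstance, inferInstance, by simp⟩

end GramTriples

/-! ### Integer coordinates on the two lattices -/

section Parametrizations

theorem mem_latticeDPlus_iff {n : ℕ} (x : EuclideanSpace ℝ (Fin n)) :
    x ∈ latticeDPlus n ↔ ∃ y : Fin n → ℤ, IsTwiceDPlus y ∧ ∀ i, x i = y i / 2 := by
  constructor
  · rintro ⟨hx, m, hm⟩
    have hsum {y : Fin n → ℤ} (hy : ∀ i, x i = y i / 2) : (∑ i, y i) % 4 = 0 := by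
      have : ((∑ i, y i : ℤ) : ℝ) = ((4 * m : ℤ) : ℝ) := by
        simp only [hy, ← Finset.sum_div] at hm
        push_cast
        linarith
      have : ∑ i, y i = 4 * m := by exact_mod_cast this
      omega
    rcases hx with hx | hx
    · choose k hk using hx
      have hy (i : Fin n) : x i = ((2 * k i : ℤ) : ℝ) / 2 := by rw [hk]; push_cast; ring
      exact ⟨fun i => 2 * k i, ⟨Or.inl fun i => show 2 * k i % 2 = 0 by omega, hsum hy⟩, hy⟩
    · choose k hk using hx
      have hy (i : Fin n) : x i = ((2 * k i + 1 : ℤ) : ℝ) / 2 := by rw [hk]; push_cast; ring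
      exact ⟨fun i => 2 * k i + 1, ⟨Or.inr fun i => show (2 * k i + 1) % 2 = 1 by omega,
        hsum hy⟩, hy⟩
  · rintro ⟨y, ⟨hy, hs⟩, hx⟩
    refine ⟨?_, (∑ i, y i) / 4, ?_⟩
    · refine hy.imp (fun hy i => ⟨y i / 2, ?_⟩) fun hy i => ⟨y i / 2, ?_⟩
      · have h2 : y i = 2 * (y i / 2) := by have := hy i; omega
        have : (y i : ℝ) = 2 * ((y i / 2 : ℤ) : ℝ) := by exact_mod_cast h2
        rw [hx]; linarith
      · have h2 : y i = 2 * (y i / 2) + 1 := by have := hy i; omega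
        have : (y i : ℝ) = 2 * ((y i / 2 : ℤ) : ℝ) + 1 := by exact_mod_cast h2
        rw [hx]; linarith
    · have h4 : ∑ i, y i = 4 * ((∑ i, y i) / 4) := by omega
      have : ((∑ i, y i : ℤ) : ℝ) = 4 * (((∑ i, y i) / 4 : ℤ) : ℝ) := by exact_mod_cast h4
      simp only [hx, ← Finset.sum_div]
      push_cast at this
      linarith

/-- The triple of half-integral vectors with the rows `z · j / 2`. -/
noncomputable def halfTriple {n : ℕ} (z : Fin n → Fin 3 → ℤ) (j : Fin 3) :
    EuclideanSpace ℝ (Fin n) := WithLp.toLp 2 fun i => (z i j : ℝ) / 2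

theorem gramParametrization_latticeDPlus (n : ℕ) : GramParametrization (latticeDPlus n)
    (fun z : Fin n → Fin 3 → ℤ => ∑ i, gramDegree (z i))
    (fun z => ∀ j, IsTwiceDPlus fun i => z i j) halfTriple where
  injective := by
    intro z w h
    funext i j
    have : (z i j : ℝ) / 2 = w i j / 2 := congrArg (fun x => x i) (congrFun h j)
    have : (z i j : ℝ) = w i j := by linarith
    exact_mod_cast this
  mem_iff := by
    intro v
    simp only [mem_latticeDPlus_iff]
    constructor
    · intro h
      choose y hy hv using h
      refine ⟨fun i j => y j i, hy, ?_⟩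
      funext j
      ext i
      exact (hv j i).symm
    · rintro ⟨z, hz, rfl⟩ j
      exact ⟨fun i => z i j, hz j, fun i => rfl⟩
  degree := by
    intro z j k
    have : (((∑ i, gramDegree (z i)) (j, k) : ℤ) : ℝ) = ((∑ i, (z i j + z i k) ^ 2 : ℤ) : ℝ) := by
      rw [sum_gramDegree_apply]
    rw [Int.cast_natCast] at this
    rw [this, EuclideanSpace.real_norm_sq_eq, Finset.mul_sum]
    push_cast
    refine Finset.sum_congr rfl fun i _ => ?_
    simp only [halfTriple, PiLp.add_apply]
    ring

theorem gramParametrization_latticeE8Sq : GramParametrization latticeE8Sq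
    (fun z : (Fin 8 → Fin 3 → ℤ) × (Fin 8 → Fin 3 → ℤ) =>
      ∑ i, gramDegree (z.1 i) + ∑ i, gramDegree (z.2 i))
    (fun z => (∀ j, IsTwiceDPlus fun i => z.1 i j) ∧ ∀ j, IsTwiceDPlus fun i => z.2 i j)
    fun z j => WithLp.toLp 2 (halfTriple z.1 j, halfTriple z.2 j) where
  injective := by
    rintro ⟨z, z'⟩ ⟨w, w'⟩ h
    have h' := gramParametrization_latticeDPlus 8
    exact Prod.ext
      (h'.injective (funext fun j => congrArg (fun x => (WithLp.ofLp x).1) (congrFun h j)))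
      (h'.injective (funext fun j => congrArg (fun x => (WithLp.ofLp x).2) (congrFun h j)))
  mem_iff := by
    intro v
    have h' := gramParametrization_latticeDPlus 8
    have hmem (j : Fin 3) : v j ∈ latticeE8Sq ↔
        (WithLp.ofLp (v j)).1 ∈ latticeDPlus 8 ∧ (WithLp.ofLp (v j)).2 ∈ latticeDPlus 8 := Iff.rfl
    simp only [hmem, forall_and]
    rw [h'.mem_iff fun j => (WithLp.ofLp (v j)).1, h'.mem_iff fun j => (WithLp.ofLp (v j)).2]
    constructor
    · rintro ⟨⟨z, hz, hzv⟩, w, hw, hwv⟩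
      refine ⟨(z, w), ⟨hz, hw⟩, funext fun j => ?_⟩
      rw [hzv, hwv]
    · rintro ⟨⟨z, w⟩, ⟨hz, hw⟩, rfl⟩
      exact ⟨⟨z, hz, rfl⟩, w, hw, rfl⟩
  degree := by
    rintro ⟨z, w⟩ j k
    have h' := gramParametrization_latticeDPlus 8
    rw [Finsupp.add_apply, Nat.cast_add, h'.degree z, h'.degree w,
      WithLp.prod_norm_sq_eq_of_L2, mul_add]
    rfl

open Classical in
theorem genSeries_latticeE8Sq :
    genSeries (fun z : (Fin 8 → Fin 3 → ℤ) × (Fin 8 → Fin 3 → ℤ) =>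
      ∑ i, gramDegree (z.1 i) + ∑ i, gramDegree (z.2 i))
      (fun z => if (∀ j, IsTwiceDPlus fun i => z.1 i j) ∧ ∀ j, IsTwiceDPlus fun i => z.2 i j
        then 1 else 0) =
    genSeries (fun z : Fin 16 → Fin 3 → ℤ => ∑ i, gramDegree (z i))
      fun z => if ∀ j, IsTwiceDPlus fun i => z i j then 1 else 0 := by
  refine Eq.trans ?_ dPlusSeries_sixteen.symm
  rw [sq, dPlusSeries, genSeries_mul finiteFibers_gramDegree.pi finiteFibers_gramDegree.pi]
  congr 1
  funext z
  rw [ite_and, ite_zero_mul, one_mul]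

theorem card_gramTriple_eq (T : Fin 3 → Fin 3 → ℝ) :
    Finite (GramTriple latticeE8Sq T) ∧ Finite (GramTriple latticeD16Plus T) ∧
      Nat.card (GramTriple latticeE8Sq T) = Nat.card (GramTriple latticeD16Plus T) := by
  have hfin (n : ℕ) : FiniteFibers fun z : Fin n → Fin 3 → ℤ => ∑ i, gramDegree (z i) :=
    finiteFibers_gramDegree.pi
  have hD : GramParametrization latticeD16Plus (fun z : Fin 16 → Fin 3 → ℤ => ∑ i, gramDegree (z i))
      (fun z => ∀ j, IsTwiceDPlus fun i => z i j) halfTriple := gramParametrization_latticeDPlus 16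
  have hfinSq (n : ℕ) : FiniteFibers fun z : (Fin n → Fin 3 → ℤ) × (Fin n → Fin 3 → ℤ) =>
      ∑ i, gramDegree (z.1 i) + ∑ i, gramDegree (z.2 i) := (hfin n).prod (hfin n)
  classical
  refine gramParametrization_latticeE8Sq.card_eq hD (hfinSq 8) (hfin 16) ?_ T
  convert genSeries_latticeE8Sq

end Parametrizations

theorem mainTheorem7 {L : Type*} [AddCommGroup L] [Module.Free ℤ L] [Module.Finite ℤ L]
    (B : L →ₗ[ℤ] L →ₗ[ℤ] ℝ) (hsymm : ∀ x y, B x y = B y x) (hpos : ∀ x, x ≠ 0 → 0 < B x x)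
    (hrank : Module.finrank ℤ L ≤ 3) :
    Finite (LatticeEmbedding B latticeE8Sq) ∧ Finite (LatticeEmbedding B latticeD16Plus) ∧
      Nat.card (LatticeEmbedding B latticeE8Sq) = Nat.card (LatticeEmbedding B latticeD16Plus) := by
  obtain ⟨b, hb⟩ := exists_span_range_eq_top hrank
  obtain ⟨f⟩ := latticeEmbedding_equiv_gramTriple B hpos hb latticeE8Sq
  obtain ⟨g⟩ := latticeEmbedding_equiv_gramTriple B hpos hb latticeD16Plus
  obtain ⟨hE, hD, hcard⟩ := card_gramTriple_eq fun j k => B (b j) (b k)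
  exact ⟨Finite.of_equiv _ f.symm, Finite.of_equiv _ g.symm,
    (Nat.card_congr f).trans (hcard.trans (Nat.card_congr g).symm)⟩
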